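/- For $n\ge 2$ let $\mathcal A_n$ be the Arnold algebra (the rational cohomology algebra of the pure braid group on $n$ strands): the quotient of the exterior algebra over $\mathbb Q$ on degree-one generators $w_{ij}=w_{ji}$ ($1\le i<j\le n$) by the two-sided ideal generated by the infinitesimal braid relations $$w_{ij}w_{ik}-w_{ij}w_{jk}+w_{ik}w_{jk}\qquad(1\le i<j<k\le n).$$ The symmetric group $\mathcal S_n$ acts on $\mathcal A_n$ by algebra automorphisms with $\pi\cdot w_{ij}=w_{\pi(i)\pi(j)}$; let $\mathcal A^k(n)$ be the degree-$k$ component, regarded as a $\mathbb Q[\mathcal S_n]$-module. For a partition $\lambda$ of $n$ let $V_\lambda$ be the irreducible $\mathbb Q[\mathcal S_n]$-module attached to $\lambda$ (the span of the polytabloids of shape $\lambda$, so that $V_{(n)}$ is trivial and $V_{(1,\dots,1)}$ is the sign representation), and for a partition $\mu=(\mu_1\ge\dots\ge\mu_s\ge 0)$ with $n-\sum_i\mu_i\ge\mu_1$ put $V(\mu)_n=V_{(n-\sum_i\mu_i,\,\mu_1,\dots,\mu_s)}$. Then there are isomorphisms of $\mathbb Q[\mathcal S_n]$-modules as follows. For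 $n\ge 4$, $$\mathcal A^1(n)\cong V(0)_n\oplus V(1)_n\oplus V(2)_n.$$ For $n\ge 7$, $$\mathcal A^2(n)\cong 2V(1)_n\oplus 2V(2)_n\oplus 2V(1,1)_n\oplus V(3)_n\oplus 2V(2,1)_n\oplus V(3,1)_n.$$ In the unstable cases, $$\mathcal A^2(2)=0,\qquad \mathcal A^2(3)\cong V_{(2,1)},\qquad \mathcal A^2(4)\cong 2V_{(3,1)}\oplus V_{(2,2)}\oplus V_{(2,1,1)},$$ $$\mathcal A^2(5)\cong 2V_{(4,1)}\oplus 2V_{(3,2)}\oplus 2V_{(3,1,1)}\oplus V_{(2,2,1)},$$ $$\mathcal A^2(6)\cong 2V_{(5,1)}\oplus 2V_{(4,2)}\oplus 2V_{(4,1,1)}\oplus V_{(3,3)}\oplus 2V_{(3,2,1)}.$$ -/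

import Mathlib

open Equiv (Perm)

noncomputable section

namespace Arnold

/-! ### The Arnold algebra and its symmetric group action -/

/-- Index set of the generators: unordered pairs `{i, j}` of distinct elements of `Fin n`. -/
abbrev Gen (n : ℕ) : Type := {e : Sym2 (Fin n) // ¬ e.IsDiag}

/-- The permutation of the index set induced by a permutation of `Fin n`:
`π {i, j} = {π i, π j}`. -/
def permGen {n : ℕ} (π : Perm (Fin n)) (e : Gen n) : Gen n :=
  ⟨Sym2.map π e.1, fun h => e.2 ((Sym2.isDiag_map π.injective).1 h)⟩

/-- The exterior algebra over `ℚ` on the degree one generators `w_{ij}`. -/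
abbrev Ext (n : ℕ) : Type := ExteriorAlgebra ℚ (Gen n →₀ ℚ)

/-- The generator `w_{ij} = w_{ji}` for `i ≠ j`. -/
def w {n : ℕ} (i j : Fin n) (h : i ≠ j) : Ext n :=
  ExteriorAlgebra.ι ℚ (Finsupp.single ⟨s(i, j), by simpa using h⟩ 1)

/-- The relation `w_{ij} w_{ik} - w_{ij} w_{jk} + w_{ik} w_{jk}`, for distinct `i, j, k`. -/
def yb {n : ℕ} (i j k : Fin n) (hij : i ≠ j) (hik : i ≠ k) (hjk : j ≠ k) : Ext n :=
  w i j hij * w i k hik - w i j hij * w j k hjk + w i k hik * w j k hjk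

/-- The infinitesimal braid relations `yb i j k = 0` for `i < j < k`. -/
inductive BraidRel (n : ℕ) : Ext n → Ext n → Prop
  | mk (i j k : Fin n) (hij : i < j) (hjk : j < k) :
      BraidRel n (yb i j k hij.ne (hij.trans hjk).ne hjk.ne) 0

/-- The Arnold algebra: the quotient of the exterior algebra on the `w_{ij}` by the two-sided
ideal generated by the infinitesimal braid relations. -/
abbrev Alg (n : ℕ) : Type := RingQuot (BraidRel n)

/-- The quotient map from the exterior algebra onto the Arnold algebra. -/
def proj (n : ℕ) : Ext n →ₐ[ℚ] Alg n := RingQuot.mkAlgHom ℚ (BraidRel n)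

/-- The action of a permutation on the exterior algebra: the algebra map with
`w_{ij} ↦ w_{π(i) π(j)}`. -/
def extAct {n : ℕ} (π : Perm (Fin n)) : Ext n →ₐ[ℚ] Ext n :=
  ExteriorAlgebra.map (Finsupp.lmapDomain ℚ ℚ (permGen π))

theorem extAct_w {n : ℕ} (π : Perm (Fin n)) (i j : Fin n) (h : i ≠ j) :
    extAct π (w i j h) = w (π i) (π j) (π.injective.ne h) := by
  simp [extAct, w, permGen]

theorem extAct_one {n : ℕ} : extAct (1 : Perm (Fin n)) = AlgHom.id ℚ (Ext n) := by
  have h : (permGen (1 : Perm (Fin n))) = id := by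
    funext e; apply Subtype.ext; simp [permGen]
  rw [extAct, h, Finsupp.lmapDomain_id, ExteriorAlgebra.map_id]

theorem extAct_mul {n : ℕ} (π σ : Perm (Fin n)) :
    extAct (π * σ) = (extAct π).comp (extAct σ) := by
  have h : permGen (π * σ) = permGen π ∘ permGen σ := by
    funext e; apply Subtype.ext; simp [permGen, Sym2.map_map]
  rw [extAct, h, Finsupp.lmapDomain_comp, extAct, extAct, ExteriorAlgebra.map_comp_map]

theorem w_symm {n : ℕ} (i j : Fin n) (h : i ≠ j) : w i j h = w j i h.symm := by
  simp only [w, Sym2.eq_swap]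

theorem w_anticomm {n : ℕ} (i j k l : Fin n) (h : i ≠ j) (h' : k ≠ l) :
    w i j h * w k l h' = - (w k l h' * w i j h) :=
  eq_neg_of_add_eq_zero_left (ExteriorAlgebra.ι_add_mul_swap _ _)

theorem yb_swap_left {n : ℕ} (i j k : Fin n) (hij : i ≠ j) (hik : i ≠ k) (hjk : j ≠ k) :
    yb j i k hij.symm hjk hik = - yb i j k hij hik hjk := by
  simp only [yb, w_symm j i hij.symm, w_anticomm j k i k hjk hik]
  abel

theorem yb_swap_right {n : ℕ} (i j k : Fin n) (hij : i ≠ j) (hik : i ≠ k) (hjk : j ≠ k) :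
    yb i k j hik hij hjk.symm = - yb i j k hij hik hjk := by
  simp only [yb, w_symm k j hjk.symm, w_anticomm i k i j hik hij]
  abel

theorem proj_yb {n : ℕ} (i j k : Fin n) (hij : i ≠ j) (hik : i ≠ k) (hjk : j ≠ k) :
    proj n (yb i j k hij hik hjk) = 0 := by
  have key : ∀ (a b c : Fin n) (hab : a < b) (hbc : b < c),
      proj n (yb a b c hab.ne (hab.trans hbc).ne hbc.ne) = 0 := by
    intro a b c hab hbc
    have := RingQuot.mkAlgHom_rel ℚ (BraidRel.mk a b c hab hbc)
    simpa [proj] using this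
  rcases lt_or_gt_of_ne hij with h1 | h1 <;> rcases lt_or_gt_of_ne hjk with h2 | h2 <;>
    rcases lt_or_gt_of_ne hik with h3 | h3
  · exact key i j k h1 h2
  · exact absurd (h1.trans h2) h3.asymm
  · have := key i k j h3 h2
    rw [yb_swap_right i j k hij hik hjk] at this
    simpa using this
  · have := key k i j h3 h1
    rw [yb_swap_left i k j hik hij hjk.symm, yb_swap_right i j k hij hik hjk] at this
    simpa using this
  · have := key j i k h1 h3
    rw [yb_swap_left i j k hij hik hjk] at this
    simpa using this
  · have := key j k i h2 h3
    rw [yb_swap_right j i k hij.symm hjk hik, yb_swap_left i j k hij hik hjk] at this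
    simpa using this
  · exact absurd (h2.trans h1) h3.asymm
  · have := key k j i h2 h1
    rw [yb_swap_left j k i hjk hij.symm hik.symm,
      yb_swap_right j i k hij.symm hjk hik, yb_swap_left i j k hij hik hjk] at this
    simpa using this

/-- The induced action of a permutation on the Arnold algebra, `w_{ij} ↦ w_{π(i) π(j)}`. -/
def act {n : ℕ} (π : Perm (Fin n)) : Alg n →ₐ[ℚ] Alg n :=
  RingQuot.liftAlgHom ℚ ⟨(proj n).comp (extAct π), by
    rintro _ _ ⟨i, j, k, hij, hjk⟩
    have h : extAct π (yb i j k hij.ne (hij.trans hjk).ne hjk.ne) =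
        yb (π i) (π j) (π k) (π.injective.ne hij.ne) (π.injective.ne (hij.trans hjk).ne)
          (π.injective.ne hjk.ne) := by
      simp only [yb, map_add, map_sub, map_mul, extAct_w]
    rw [AlgHom.comp_apply, h, proj_yb, map_zero]⟩

theorem act_proj {n : ℕ} (π : Perm (Fin n)) (x : Ext n) :
    act π (proj n x) = proj n (extAct π x) := by
  simp [act, proj]

theorem proj_surjective (n : ℕ) : Function.Surjective (proj n) :=
  RingQuot.mkAlgHom_surjective ℚ (BraidRel n)

/-- The representation of the symmetric group on the Arnold algebra. -/
def algRep (n : ℕ) : Representation ℚ (Perm (Fin n)) (Alg n) where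
  toFun π := (act π).toLinearMap
  map_one' := by
    ext x
    obtain ⟨y, rfl⟩ := proj_surjective n x
    simp [act_proj, extAct_one]
  map_mul' π σ := by
    ext x
    obtain ⟨y, rfl⟩ := proj_surjective n x
    simp [act_proj, extAct_mul]

/-- The degree `k` component of the Arnold algebra, as a subrepresentation: the image of the
`k`-th exterior power of the span of the generators. -/
def component (n k : ℕ) : Subrepresentation (algRep n) where
  toSubmodule := (⋀[ℚ]^k (Gen n →₀ ℚ)).map (proj n).toLinearMap
  apply_mem_toSubmodule := by
    rintro π _ ⟨y, hy, rfl⟩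
    refine ⟨extAct π y, ?_, (act_proj π y).symm⟩
    have h : (⋀[ℚ]^k (Gen n →₀ ℚ)).map (extAct π).toLinearMap ≤ ⋀[ℚ]^k (Gen n →₀ ℚ) := by
      rw [Submodule.map_pow]
      refine pow_le_pow_left' ?_ k
      rintro _ ⟨_, ⟨v, rfl⟩, rfl⟩
      exact ⟨Finsupp.lmapDomain ℚ ℚ (permGen π) v, by simp [extAct]⟩
    exact h ⟨y, hy, rfl⟩

/-- The representation of the symmetric group on the degree `k` component of the Arnold
algebra. -/
def componentRep (n k : ℕ) :
    Representation ℚ (Perm (Fin n)) (component n k).toSubmodule :=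
  (component n k).toRepresentation

/-! ### The irreducible modules of the symmetric group

A partition of `n` is given by its list of parts in weakly decreasing order. -/

/-- The cells of the Young diagram with row lengths `l`: the cell `⟨i, j⟩` is in row `i` and
column `j`. -/
abbrev Cell (l : List ℕ) : Type := Σ i : Fin l.length, Fin (l.get i)

/-- A tableau of shape `l`: a bijective filling of the cells by the elements of `Fin n`. -/
abbrev Tableau (n : ℕ) (l : List ℕ) : Type := Cell l ≃ Fin n

/-- The row of the tableau `t` that contains `x`. -/
def Tableau.row {n : ℕ} {l : List ℕ} (t : Tableau n l) (x : Fin n) : Fin l.length :=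
  (t.symm x).1

/-- The column of the tableau `t` that contains `x`. -/
def Tableau.col {n : ℕ} {l : List ℕ} (t : Tableau n l) (x : Fin n) : ℕ :=
  (t.symm x).2

/-- A tabloid of shape `l`: an ordered set partition of `Fin n` whose `i`-th block has `l_i`
elements, given by the function that sends an element to the number of its block. -/
@[ext] structure Tabloid (n : ℕ) (l : List ℕ) where
  row : Fin n → Fin l.length
  card_row : ∀ i, Nat.card {x // row x = i} = l.get i

/-- The tabloid of a tableau: its rows, each considered as a set. -/
def Tableau.tabloid {n : ℕ} {l : List ℕ} (t : Tableau n l) : Tabloid n l where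
  row := t.row
  card_row i := by
    have e : {x // t.row x = i} ≃ {c : Cell l // c.1 = i} :=
      t.symm.subtypeEquiv fun _ => Iff.rfl
    rw [Nat.card_congr (e.trans (Equiv.sigmaSubtype i)), Nat.card_fin]

/-- Permutations act on tabloids by permuting the entries. -/
instance (n : ℕ) (l : List ℕ) : MulAction (Perm (Fin n)) (Tabloid n l) where
  smul π T :=
    { row := fun x => T.row (π⁻¹ x)
      card_row := fun i => by
        rw [← T.card_row i]
        exact Nat.card_congr ((π⁻¹).subtypeEquiv fun _ => Iff.rfl) }
  one_smul _ := rfl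
  mul_smul _ _ _ := rfl

theorem Tableau.smul_tabloid {n : ℕ} {l : List ℕ} (t : Tableau n l) (π : Perm (Fin n)) :
    π • t.tabloid = Tableau.tabloid (t.trans π) := rfl

theorem Tableau.col_trans {n : ℕ} {l : List ℕ} (t : Tableau n l) (π : Perm (Fin n))
    (x : Fin n) : Tableau.col (t.trans π) x = t.col (π⁻¹ x) := rfl

/-- The permutation module on the tabloids of shape `l`. -/
def tabloidRep (n : ℕ) (l : List ℕ) : Representation ℚ (Perm (Fin n)) (Tabloid n l →₀ ℚ) where
  toFun π := Finsupp.lmapDomain ℚ ℚ (π • ·)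
  map_one' := by ext; simp
  map_mul' π σ := by ext; simp [mul_smul]

/-- The column stabilizer of a tableau. -/
def Tableau.colStab {n : ℕ} {l : List ℕ} (t : Tableau n l) : Finset (Perm (Fin n)) :=
  Finset.univ.filter fun σ => ∀ x, t.col (σ x) = t.col x

/-- The polytabloid of a tableau: the alternating sum of the translates of its tabloid under
the column stabilizer. -/
def Tableau.polytabloid {n : ℕ} {l : List ℕ} (t : Tableau n l) : Tabloid n l →₀ ℚ :=
  ∑ σ ∈ t.colStab, Finsupp.single (σ • t.tabloid) ((Perm.sign σ : ℤ) : ℚ)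

theorem tabloidRep_polytabloid {n : ℕ} {l : List ℕ} (t : Tableau n l) (π : Perm (Fin n)) :
    tabloidRep n l π t.polytabloid = Tableau.polytabloid (t.trans π) := by
  simp only [Tableau.polytabloid, tabloidRep, MonoidHom.coe_mk, OneHom.coe_mk, map_sum,
    Finsupp.lmapDomain_apply, Finsupp.mapDomain_single]
  refine Finset.sum_bij' (fun σ _ => π * σ * π⁻¹) (fun σ _ => π⁻¹ * σ * π) ?_ ?_ ?_ ?_ ?_
  · intro σ hσ
    simp only [Tableau.colStab, Finset.mem_filter, Finset.mem_univ, true_and] at hσ ⊢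
    intro x
    rw [Tableau.col_trans, Tableau.col_trans, ← hσ (π⁻¹ x)]
    simp [Perm.mul_apply]
  · intro σ hσ
    simp only [Tableau.colStab, Finset.mem_filter, Finset.mem_univ, true_and] at hσ ⊢
    intro x
    have h := hσ (π x)
    rw [Tableau.col_trans, Tableau.col_trans] at h
    simpa [Perm.mul_apply] using h
  · intro σ _; group
  · intro σ _; group
  · intro σ _
    rw [← Tableau.smul_tabloid, smul_smul, smul_smul]
    have e : Perm.sign (π * σ * π⁻¹) = Perm.sign σ := by
      rw [Perm.sign_mul, Perm.sign_mul, Perm.sign_inv, mul_right_comm, Int.units_mul_self, one_mul]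
    rw [e, inv_mul_cancel_right]

/-- The span of the polytabloids of shape `l`. -/
def spechtSub (n : ℕ) (l : List ℕ) : Subrepresentation (tabloidRep n l) where
  toSubmodule := Submodule.span ℚ (Set.range fun t : Tableau n l => t.polytabloid)
  apply_mem_toSubmodule := by
    intro π v hv
    have h : Submodule.span ℚ (Set.range fun t : Tableau n l => t.polytabloid) ≤
        (Submodule.span ℚ (Set.range fun t : Tableau n l => t.polytabloid)).comap
          (tabloidRep n l π) := by
      rw [Submodule.span_le]
      rintro _ ⟨t, rfl⟩
      exact Submodule.subset_span ⟨t.trans π, (tabloidRep_polytabloid t π).symm⟩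
    exact h hv

/-- The irreducible module `V_l` (Specht module) of the symmetric group on `n` letters, for a partition
`l = [l₁, l₂, …]` of `n`: the span of the polytabloids of shape `l`. -/
def specht (n : ℕ) (l : List ℕ) : Representation ℚ (Perm (Fin n)) (spechtSub n l).toSubmodule :=
  (spechtSub n l).toRepresentation

/-- The partition `(n - ∑ μᵢ, μ₁, μ₂, …)` of `n`, for a partition `μ` with
`n - ∑ μᵢ ≥ μ₁`. Its module is denoted `V(μ)_n`; the zero partition is `[]`. -/
def pad (n : ℕ) (μ : List ℕ) : List ℕ := (n - μ.sum) :: μ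

/-- `ρ ≅ ⨁ m_λ V_λ`, the direct sum over the entries `(m_λ, λ)` of the list `L`. -/
def DecomposesAs {n : ℕ} {W : Type} [AddCommGroup W] [Module ℚ W]
    (ρ : Representation ℚ (Perm (Fin n)) W) (L : List (ℕ × List ℕ)) : Prop :=
  Nonempty (ρ.Equiv (Representation.directSum
    fun i : (Σ a : Fin L.length, Fin (L.get a).1) => specht n (L.get i.1).2))

end Arnold

end

open Arnold

open Equiv (Perm)

noncomputable section

namespace Arnold

/-! ### Signed column sums -/

section ColumnSums

variable {n : ℕ} {l l' : List ℕ}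

/-! Write M^λ for the permutation module on tabloids of shape λ, S^λ ⊆ M^λ for the span of the
polytabloids e_t, and κ_t for the signed column sum of t. A family of functionals on W that is
indexed by tabloids and permuted by the group is an equivariant map M^λ → W*, and it restricts to
S^λ → W*. The proof produces enough such maps into the dual of the degree one or two component to
make the sum of their restrictions injective on the proposed direct sum of Specht modules. Dually
the component surjects equivariantly onto that sum, and a comparison of dimensions makes the
surjection an isomorphism (`decomposesAs_of_detects`). Neither characters nor the irreducibility of
S^λ enter.

Injectivity (`extend_sum_injective`) follows James: κ_t kills M^μ unless the shape of t dominates μ,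
it maps M^λ into the line of e_t, and no nonzero element of S^λ is killed by every κ_t. If the
shapes are listed compatibly with dominance, a suitable κ_t reduces a linear relation to its last
shape, where it reads ∑ c_k F_k(e_t) = 0. On a vector x that alternates under the column stabilizer,
F_k(e_t) takes the value |C_t| f_k({t})(x), so a single nonzero value of f_k at such a vector, with
the other families vanishing there, kills c_k.

A functional of degree two is an alternating form on the generators that respects the braid
relations (`quadFunctional`). The forms used depend only on the rows of the endpoints, and are
supported either on pairs of edges that meet or on pairs that are disjoint; the braid relations
constrain only the former. A shape detected on both kinds has multiplicity two. The test vectors use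
two columns for meeting edges and three for disjoint ones, so a shape with first row 2 keeps only
its meeting copy, which accounts for the smaller multiplicities in the unstable cases.

For the dimensions, the braid relations rewrite every quadratic monomial in products with distinct
larger endpoints (`component_two_le_span`), while standard tableaux, encoded as ballot words and
counted by removing the last letter, bound dim S^λ from below. The two bounds coincide. -/

theorem Tableau.mem_colStab {t : Tableau n l} {σ : Perm (Fin n)} :
    σ ∈ t.colStab ↔ ∀ x, t.col (σ x) = t.col x := by
  simp [Tableau.colStab]

theorem Tableau.one_mem_colStab (t : Tableau n l) : (1 : Perm (Fin n)) ∈ t.colStab := by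
  simp [Tableau.mem_colStab]

theorem Tableau.mul_mem_colStab {t : Tableau n l} {σ τ : Perm (Fin n)} (hσ : σ ∈ t.colStab)
    (hτ : τ ∈ t.colStab) : σ * τ ∈ t.colStab := by
  rw [Tableau.mem_colStab] at *
  intro x
  rw [Perm.mul_apply, hσ, hτ]

theorem Tableau.inv_mem_colStab {t : Tableau n l} {σ : Perm (Fin n)} (hσ : σ ∈ t.colStab) :
    σ⁻¹ ∈ t.colStab := by
  rw [Tableau.mem_colStab] at *
  intro x
  rw [← hσ (σ⁻¹ x)]
  simp

theorem Tableau.swap_mem_colStab {t : Tableau n l} {x y : Fin n} (h : t.col x = t.col y) :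
    Equiv.swap x y ∈ t.colStab := by
  rw [Tableau.mem_colStab]
  intro z
  rcases eq_or_ne z x with rfl | hx
  · rw [Equiv.swap_apply_left, h]
  · rcases eq_or_ne z y with rfl | hy
    · rw [Equiv.swap_apply_right, h]
    · rw [Equiv.swap_apply_of_ne_of_ne hx hy]

theorem cell_ext {a b : Cell l} (hr : a.1 = b.1) (hc : (a.2 : ℕ) = b.2) : a = b := by
  obtain ⟨i, j⟩ := a
  obtain ⟨i', j'⟩ := b
  obtain rfl : i = i' := hr
  congr 1
  exact Fin.ext hc

theorem Tableau.ext_row_col (t : Tableau n l) {x y : Fin n} (hr : t.row x = t.row y)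
    (hc : t.col x = t.col y) : x = y :=
  t.symm.injective (cell_ext hr hc)

@[simp] theorem Tableau.row_apply (t : Tableau n l) (c : Cell l) : t.row (t c) = c.1 := by
  simp [Tableau.row]

@[simp] theorem Tableau.col_apply (t : Tableau n l) (c : Cell l) : t.col (t c) = c.2 := by
  rw [Tableau.col, Equiv.symm_apply_apply]

theorem Tableau.col_lt (t : Tableau n l) (x : Fin n) : t.col x < l.get (t.row x) :=
  (t.symm x).2.2

/-- The signed column sum of a tableau, acting on a permutation module. -/
def Tableau.colSum (t : Tableau n l) (l' : List ℕ) :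
    (Tabloid n l' →₀ ℚ) →ₗ[ℚ] (Tabloid n l' →₀ ℚ) :=
  ∑ σ ∈ t.colStab, ((Perm.sign σ : ℤ) : ℚ) • tabloidRep n l' σ

theorem tabloidRep_single (π : Perm (Fin n)) (T : Tabloid n l) (c : ℚ) :
    tabloidRep n l π (Finsupp.single T c) = Finsupp.single (π • T) c := by
  simp [tabloidRep]

theorem Tableau.colSum_single (t : Tableau n l) (T : Tabloid n l') :
    t.colSum l' (Finsupp.single T 1) =
      ∑ σ ∈ t.colStab, Finsupp.single (σ • T) ((Perm.sign σ : ℤ) : ℚ) := by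
  simp [Tableau.colSum, LinearMap.sum_apply, tabloidRep_single]

theorem Tabloid.smul_row (π : Perm (Fin n)) (T : Tabloid n l) (x : Fin n) :
    (π • T).row x = T.row (π⁻¹ x) := rfl

/-- The signed column sum kills a tabloid with two elements of a column in one row. -/
theorem Tableau.colSum_single_eq_zero (t : Tableau n l) (T : Tabloid n l') {x y : Fin n}
    (hxy : x ≠ y) (hc : t.col x = t.col y) (hr : T.row x = T.row y) :
    t.colSum l' (Finsupp.single T 1) = 0 := by
  have hT : Equiv.swap x y • T = T := by
    ext z
    rw [Tabloid.smul_row, Equiv.swap_inv]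
    rcases eq_or_ne z x with rfl | hx
    · rw [Equiv.swap_apply_left, hr]
    · rcases eq_or_ne z y with rfl | hy
      · rw [Equiv.swap_apply_right, hr]
      · rw [Equiv.swap_apply_of_ne_of_ne hx hy]
  rw [Tableau.colSum_single]
  -- Right multiplication by the transposition fixes σ • T and reverses the sign, so the terms
  -- cancel in pairs.
  refine Finset.sum_involution (fun σ _ => σ * Equiv.swap x y) ?_ ?_ ?_ ?_
  · intro σ _
    rw [mul_smul, hT, ← Finsupp.single_add, Perm.sign_mul, Perm.sign_swap hxy]
    simp
  · intro σ _ _ h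
    exact hxy (Equiv.swap_eq_one_iff.1 (mul_eq_left.1 h))
  · intro σ hσ
    exact Tableau.mul_mem_colStab hσ (Tableau.swap_mem_colStab hc)
  · intro σ _
    rw [mul_assoc, Equiv.swap_mul_self, mul_one]

/-- κ_t τ = sgn(τ) κ_t for τ in the column stabilizer. -/
theorem Tableau.colSum_smul_tabloid (t : Tableau n l) {τ : Perm (Fin n)} (hτ : τ ∈ t.colStab) :
    t.colSum l (Finsupp.single (τ • t.tabloid) 1) =
      ((Perm.sign τ : ℤ) : ℚ) • t.polytabloid := by
  rw [Tableau.colSum_single, Tableau.polytabloid, Finset.smul_sum]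
  refine Finset.sum_bij' (fun σ _ => σ * τ) (fun σ _ => σ * τ⁻¹) ?_ ?_ ?_ ?_ ?_
  · exact fun σ hσ => Tableau.mul_mem_colStab hσ hτ
  · exact fun σ hσ => Tableau.mul_mem_colStab hσ (Tableau.inv_mem_colStab hτ)
  · intro σ _; group
  · intro σ _; group
  · intro σ _
    rw [mul_smul, Finsupp.smul_single, smul_eq_mul, Perm.sign_mul]
    congr 1
    rw [← Int.cast_mul, ← Units.val_mul, mul_comm (Perm.sign σ), ← mul_assoc, Int.units_mul_self,
      one_mul]

/-! ### Dominance -/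

theorem card_lt_eq_sum_take {r : Fin n → ℕ}
    (h : ∀ i, (Finset.univ.filter fun x => r x = i).card = l.getD i 0) (k : ℕ) :
    (Finset.univ.filter fun x => r x < k).card = (l.take k).sum := by
  induction k with
  | zero => simp
  | succ k ih =>
    have : (Finset.univ.filter fun x => r x < k + 1) =
        (Finset.univ.filter fun x => r x < k) ∪ Finset.univ.filter fun x => r x = k := by
      ext x; simp; omega
    rw [this, Finset.card_union_of_disjoint, ih, h]
    · by_cases hk : k < l.length
      · rw [List.sum_take_succ _ _ hk, List.getD_eq_getElem _ _ hk]
      · rw [List.getD_eq_default _ _ (by omega), List.take_of_length_le (by omega),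
          List.take_of_length_le (by omega), add_zero]
    · rw [Finset.disjoint_filter]
      intro x _ h1 h2
      omega

theorem Tabloid.card_row_eq (T : Tabloid n l) (i : ℕ) :
    (Finset.univ.filter fun x => (T.row x : ℕ) = i).card = l.getD i 0 := by
  by_cases hi : i < l.length
  · have := T.card_row ⟨i, hi⟩
    rw [Nat.card_eq_fintype_card, Fintype.card_subtype] at this
    rw [List.getD_eq_getElem _ _ hi]
    simpa [Fin.ext_iff] using this
  · rw [List.getD_eq_default _ _ (by omega), Finset.card_eq_zero, Finset.filter_eq_empty_iff]
    intro x _ h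
    exact hi (h ▸ (T.row x).2)

theorem Tabloid.card_row_lt (T : Tabloid n l) (k : ℕ) :
    (Finset.univ.filter fun x => (T.row x : ℕ) < k).card = (l.take k).sum :=
  card_lt_eq_sum_take T.card_row_eq k

/-- If column c of `t` reaches row k, it fills all of the first k rows of `t`, whereas its entries
lie in distinct rows of `T`, so at most k of them can be in the first k rows there. Otherwise the
whole column is counted on the right. Summed over c, this is the dominance inequality. -/
theorem Tableau.card_col_le (hl : l.Pairwise (· ≥ ·)) (t : Tableau n l) (T : Tabloid n l')
    (hT : ∀ x y, t.col x = t.col y → T.row x = T.row y → x = y) (k c : ℕ) :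
    (Finset.univ.filter fun x => (T.row x : ℕ) < k ∧ t.col x = c).card ≤
      (Finset.univ.filter fun x => (t.row x : ℕ) < k ∧ t.col x = c).card := by
  by_cases h : ∃ x, t.col x = c ∧ k ≤ (t.row x : ℕ)
  · obtain ⟨x, hx, hk⟩ := h
    have h1 : (Finset.univ.filter fun x => (T.row x : ℕ) < k ∧ t.col x = c).card ≤
        (Finset.range k).card := by
      refine Finset.card_le_card_of_injOn (fun x => (T.row x : ℕ)) ?_ ?_
      · intro y hy
        simpa using (Finset.mem_filter.1 hy).2.1
      · intro y hy z hz hyz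
        have hy' := (Finset.mem_filter.1 hy).2.2
        have hz' := (Finset.mem_filter.1 hz).2.2
        exact hT y z (hy'.trans hz'.symm) (Fin.ext hyz)
    refine h1.trans ?_
    have hlt : ∀ i : Fin k, c < l.get ⟨i, (i.2.trans_le hk).trans (t.row x).2⟩ := by
      intro i
      have h2 := t.col_lt x
      rw [hx] at h2
      refine h2.trans_le ?_
      exact List.pairwise_iff_get.1 hl _ _ (Fin.lt_def.2 (i.2.trans_le hk))
    have h3 : (Finset.univ : Finset (Fin k)).card ≤
        (Finset.univ.filter fun x => (t.row x : ℕ) < k ∧ t.col x = c).card := by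
      refine Finset.card_le_card_of_injOn (fun i => t ⟨_, ⟨c, hlt i⟩⟩) ?_ ?_
      · intro i _
        simp
      · intro i _ j _ hij
        have := congrArg (fun z => (t.row z : ℕ)) hij
        simp only [Tableau.row_apply] at this
        exact Fin.ext this
    simpa using h3
  · push Not at h
    refine Finset.card_le_card ?_
    intro x hx
    simp only [Finset.mem_filter, Finset.mem_univ, true_and] at hx ⊢
    exact ⟨h x hx.2, hx.2⟩

theorem card_filter_eq_sum_col (c : Fin n → ℕ) (p : Fin n → Prop) [DecidablePred p] :
    (Finset.univ.filter p).card =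
      ∑ j ∈ Finset.univ.image c, (Finset.univ.filter fun x => p x ∧ c x = j).card := by
  rw [Finset.card_eq_sum_card_fiberwise (f := c) (t := Finset.univ.image c)]
  · simp only [Finset.filter_filter]
  · intro x _
    simp

/-- The signed column sum of a tableau kills the permutation modules of all shapes that its shape
does not dominate. -/
theorem Tableau.colSum_eq_zero (hl : l.Pairwise (· ≥ ·)) (t : Tableau n l) {k : ℕ}
    (hk : (l.take k).sum < (l'.take k).sum) : t.colSum l' = 0 := by
  ext1 T
  ext1
  simp only [LinearMap.comp_apply, Finsupp.lsingle_apply, LinearMap.zero_apply]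
  by_cases hT : ∀ x y, t.col x = t.col y → T.row x = T.row y → x = y
  · exfalso
    rw [← T.card_row_lt, ← t.tabloid.card_row_lt, card_filter_eq_sum_col t.col,
      card_filter_eq_sum_col t.col (fun x => (T.row x : ℕ) < k)] at hk
    exact hk.not_ge (Finset.sum_le_sum fun c _ => t.card_col_le hl T hT k c)
  · push Not at hT
    obtain ⟨x, y, hc, hr, hxy⟩ := hT
    exact t.colSum_single_eq_zero T hxy hc hr

/-- The equality case of dominance: each column has its entries in the same set of rows of `T` as of
`t`, so rearranging entries within the columns carries one tabloid to the other. -/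
theorem Tableau.exists_colStab_smul (hl : l.Pairwise (· ≥ ·)) (t : Tableau n l) (T : Tabloid n l)
    (hT : ∀ x y, t.col x = t.col y → T.row x = T.row y → x = y) :
    ∃ σ ∈ t.colStab, T = σ • t.tabloid := by
  -- The shapes agree, so the columnwise inequalities of `card_col_le` have equal sums and are all
  -- equalities.
  have heq : ∀ k, ∀ c ∈ Finset.univ.image t.col,
      (Finset.univ.filter fun x => (T.row x : ℕ) < k ∧ t.col x = c).card =
      (Finset.univ.filter fun x => (t.row x : ℕ) < k ∧ t.col x = c).card := by
    intro k
    rw [← Finset.sum_eq_sum_iff_of_le fun c _ => t.card_col_le hl T hT k c,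
      ← card_filter_eq_sum_col t.col (fun x => (T.row x : ℕ) < k),
      ← card_filter_eq_sum_col t.col (fun x => (t.row x : ℕ) < k), T.card_row_lt]
    exact (t.tabloid.card_row_lt k).symm
  have hex : ∀ x, ∃ y, t.row y = T.row x ∧ t.col y = t.col x := by
    intro x
    have hc : t.col x ∈ Finset.univ.image t.col := by simp
    have h1 := heq (T.row x) _ hc
    have h2 := heq (T.row x + 1) _ hc
    -- Without such y, passing from the rows below `T.row x` to one row more would add nothing to
    -- the count for `t` in this column, yet it adds x to the count for `T`.
    by_contra! hno
    have h3 : (Finset.univ.filter fun y => (t.row y : ℕ) < T.row x + 1 ∧ t.col y = t.col x) ⊆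
        (Finset.univ.filter fun y => (t.row y : ℕ) < T.row x ∧ t.col y = t.col x) := by
      intro y hy
      simp only [Finset.mem_filter, Finset.mem_univ, true_and] at hy ⊢
      have : (t.row y : ℕ) ≠ T.row x := fun h => hno y (Fin.ext h) hy.2
      exact ⟨by omega, hy.2⟩
    have h4 := Finset.card_le_card h3
    have h5 : (Finset.univ.filter fun y => (T.row y : ℕ) < T.row x ∧ t.col y = t.col x) ⊂
        (Finset.univ.filter fun y => (T.row y : ℕ) < T.row x + 1 ∧ t.col y = t.col x) := by
      rw [Finset.ssubset_iff_of_subset]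
      · exact ⟨x, by simp, by simp⟩
      · intro y hy
        simp only [Finset.mem_filter, Finset.mem_univ, true_and] at hy ⊢
        exact ⟨by omega, hy.2⟩
    have := Finset.card_lt_card h5
    omega
  choose f hfr hfc using hex
  have hf : Function.Injective f := by
    intro x y hxy
    exact hT x y (by rw [← hfc x, ← hfc y, hxy]) (by rw [← hfr x, ← hfr y, hxy])
  let τ : Perm (Fin n) := Equiv.ofBijective f (Finite.injective_iff_bijective.1 hf)
  have hτ : τ ∈ t.colStab := by
    rw [Tableau.mem_colStab]
    exact hfc
  refine ⟨τ⁻¹, Tableau.inv_mem_colStab hτ, ?_⟩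
  ext x
  rw [Tabloid.smul_row, inv_inv]
  exact congrArg Fin.val (hfr x).symm

theorem Tableau.exists_colSum_eq_smul (hl : l.Pairwise (· ≥ ·)) (t : Tableau n l)
    (y : Tabloid n l →₀ ℚ) : ∃ c : ℚ, t.colSum l y = c • t.polytabloid := by
  induction y using Finsupp.induction_linear with
  | zero => exact ⟨0, by simp⟩
  | add y z hy hz =>
    obtain ⟨c, hc⟩ := hy
    obtain ⟨d, hd⟩ := hz
    exact ⟨c + d, by rw [map_add, hc, hd, add_smul]⟩
  | single T a =>
    have : Finsupp.single T a = a • Finsupp.single T (1 : ℚ) := by simp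
    rw [this, map_smul]
    by_cases hT : ∀ x y, t.col x = t.col y → T.row x = T.row y → x = y
    · obtain ⟨σ, hσ, rfl⟩ := t.exists_colStab_smul hl T hT
      rw [t.colSum_smul_tabloid hσ, smul_smul]
      exact ⟨_, rfl⟩
    · push Not at hT
      obtain ⟨x, y, hc, hr, hxy⟩ := hT
      rw [t.colSum_single_eq_zero T hxy hc hr]
      exact ⟨0, by simp⟩

/-- κ_t is self-adjoint for the pairing in which tabloids are orthonormal, so ⟨κ_t y, {t}⟩ = ⟨y,
e_t⟩; the linear combination with coefficients `y` is the pairing with y. -/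
theorem Tableau.colSum_apply_tabloid (t : Tableau n l) (y : Tabloid n l →₀ ℚ) :
    t.colSum l y t.tabloid = Finsupp.linearCombination ℚ (y : Tabloid n l → ℚ) t.polytabloid := by
  have h1 : ∀ σ : Perm (Fin n), tabloidRep n l σ y t.tabloid = y (σ⁻¹ • t.tabloid) := by
    intro σ
    have : t.tabloid = σ • (σ⁻¹ • t.tabloid) := by rw [smul_inv_smul]
    conv_lhs => rw [this]
    exact Finsupp.mapDomain_apply (MulAction.injective σ) y _
  simp only [Tableau.colSum, LinearMap.sum_apply, LinearMap.smul_apply, Finsupp.finsetSum_apply,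
    Finsupp.smul_apply, h1, Tableau.polytabloid, map_sum, Finsupp.linearCombination_single]
  refine Finset.sum_bij' (fun σ _ => σ⁻¹) (fun σ _ => σ⁻¹) ?_ ?_ ?_ ?_ ?_
  · exact fun σ hσ => Tableau.inv_mem_colStab hσ
  · exact fun σ hσ => Tableau.inv_mem_colStab hσ
  · simp
  · simp
  · simp

/-- A nonzero element of the span of the polytabloids has a nonzero signed column sum. -/
theorem exists_colSum_ne_zero {y : Tabloid n l →₀ ℚ} (hy : y ∈ (spechtSub n l).toSubmodule)
    (h0 : y ≠ 0) : ∃ t : Tableau n l, t.colSum l y ≠ 0 := by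
  by_contra! h
  apply h0
  have hle : (spechtSub n l).toSubmodule ≤
      LinearMap.ker (Finsupp.linearCombination ℚ (y : Tabloid n l → ℚ)) := by
    refine Submodule.span_le.2 ?_
    rintro _ ⟨t, rfl⟩
    rw [SetLike.mem_coe, LinearMap.mem_ker, ← t.colSum_apply_tabloid, h, Finsupp.zero_apply]
  -- Now y is orthogonal to the space that contains it, so ∑ y(T)² = 0, which forces y = 0 over ℚ.
  have h1 := hle hy
  simp only [LinearMap.mem_ker, Finsupp.linearCombination_apply, Finsupp.sum, smul_eq_mul] at h1
  rw [Finset.sum_eq_zero_iff_of_nonneg fun T _ => mul_self_nonneg (y T)] at h1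
  ext T
  by_cases hT : T ∈ y.support
  · simpa using h1 T hT
  · simpa using hT

end ColumnSums

/-! ### A criterion for the decomposition of a representation -/

instance (n : ℕ) (l : List ℕ) : Finite (Tabloid n l) :=
  Finite.of_injective (fun T : Tabloid n l => T.row) fun _ _ h => Tabloid.ext h

section Criterion

variable {n : ℕ} {l : List ℕ} {W : Type} [AddCommGroup W] [Module ℚ W]

/-- A family of functionals on `ρ`, indexed by the tabloids of a shape, that permutations
permute. -/
def IsTabloidFamily (ρ : Representation ℚ (Perm (Fin n)) W) (f : Tabloid n l → Module.Dual ℚ W) :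
    Prop :=
  ∀ π T x, f (π • T) (ρ π x) = f T x

/-- The vector `x` changes by the sign under the column stabilizer of `t`. -/
def IsColAlternating (ρ : Representation ℚ (Perm (Fin n)) W) (t : Tableau n l) (x : W) : Prop :=
  ∀ σ ∈ t.colStab, ρ σ x = ((Perm.sign σ : ℤ) : ℚ) • x

/-- There are `m` families of functionals indexed by the tabloids of shape `l` that are
separated by column alternating vectors. -/
def Detects (ρ : Representation ℚ (Perm (Fin n)) W) (l : List ℕ) (m : ℕ) : Prop :=
  ∃ f : Fin m → Tabloid n l → Module.Dual ℚ W, (∀ k, IsTabloidFamily ρ (f k)) ∧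
    ∀ k, ∃ (t : Tableau n l) (x : W), IsColAlternating ρ t x ∧ f k t.tabloid x ≠ 0 ∧
      ∀ k', k' ≠ k → f k' t.tabloid x = 0

variable {ρ : Representation ℚ (Perm (Fin n)) W}

/-- The linear extension of a family of functionals. -/
abbrev extend (f : Tabloid n l → Module.Dual ℚ W) : (Tabloid n l →₀ ℚ) →ₗ[ℚ] Module.Dual ℚ W :=
  Finsupp.linearCombination ℚ f

theorem IsTabloidFamily.extend_apply {f : Tabloid n l → Module.Dual ℚ W}
    (hf : IsTabloidFamily ρ f) (π : Perm (Fin n)) (y : Tabloid n l →₀ ℚ) (x : W) :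
    extend f (tabloidRep n l π y) (ρ π x) = extend f y x := by
  induction y using Finsupp.induction_linear with
  | zero => simp
  | add y z hy hz => simp only [map_add, LinearMap.add_apply, hy, hz]
  | single T a =>
    rw [tabloidRep_single, Finsupp.linearCombination_single, Finsupp.linearCombination_single,
      LinearMap.smul_apply, LinearMap.smul_apply, hf]

theorem IsTabloidFamily.extend_rep {f : Tabloid n l → Module.Dual ℚ W}
    (hf : IsTabloidFamily ρ f) (π : Perm (Fin n)) (y : Tabloid n l →₀ ℚ) (x : W) :
    extend f (tabloidRep n l π y) x = extend f y (ρ π⁻¹ x) := by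
  rw [← hf.extend_apply π y (ρ π⁻¹ x), ← Module.End.mul_apply, ← map_mul, mul_inv_cancel,
    map_one, Module.End.one_apply]

theorem sign_mul_sign_inv (σ : Perm (Fin n)) :
    ((Perm.sign σ : ℤ) : ℚ) * ((Perm.sign σ⁻¹ : ℤ) : ℚ) = 1 := by
  rw [Perm.sign_inv, ← Int.cast_mul, ← Units.val_mul, Int.units_mul_self]
  simp

/-- Moving σ from the tabloid to x produces a second factor sgn σ, so all terms of the polytabloid
contribute equally and nothing cancels. -/
theorem IsTabloidFamily.extend_polytabloid {f : Tabloid n l → Module.Dual ℚ W}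
    (hf : IsTabloidFamily ρ f) (t : Tableau n l) {x : W} (hx : IsColAlternating ρ t x) :
    extend f t.polytabloid x = (t.colStab.card : ℚ) * f t.tabloid x := by
  have h : ∀ σ ∈ t.colStab,
      extend f (Finsupp.single (σ • t.tabloid) ((Perm.sign σ : ℤ) : ℚ)) x = f t.tabloid x := by
    intro σ hσ
    have h1 := hf σ t.tabloid (ρ σ⁻¹ x)
    rw [← Module.End.mul_apply, ← map_mul, mul_inv_cancel, map_one, Module.End.one_apply,
      hx _ (Tableau.inv_mem_colStab hσ), map_smul] at h1
    rw [Finsupp.linearCombination_single, LinearMap.smul_apply, h1, smul_smul, sign_mul_sign_inv,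
      one_smul]
  rw [Tableau.polytabloid, map_sum, LinearMap.sum_apply, Finset.sum_congr rfl h]
  simp

theorem Tableau.card_colStab_ne_zero (t : Tableau n l) : (t.colStab.card : ℚ) ≠ 0 :=
  Nat.cast_ne_zero.2 (Finset.card_ne_zero_of_mem t.one_mem_colStab)

/-- The vector `x` for index k is tied to its own tableau t. A relation at s is moved to t by the
permutation that takes s to t, and evaluation at x then isolates c k. -/
theorem extend_polytabloid_independent {m : ℕ} {f : Fin m → Tabloid n l → Module.Dual ℚ W}
    (hf : ∀ k, IsTabloidFamily ρ (f k))
    (hx : ∀ k, ∃ (t : Tableau n l) (x : W), IsColAlternating ρ t x ∧ f k t.tabloid x ≠ 0 ∧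
      ∀ k', k' ≠ k → f k' t.tabloid x = 0)
    (s : Tableau n l) (c : Fin m → ℚ) (hc : ∑ k, c k • extend (f k) s.polytabloid = 0)
    (k : Fin m) : c k = 0 := by
  obtain ⟨t, x, hxt, h1, h2⟩ := hx k
  have ht : t.polytabloid = tabloidRep n l (s.symm.trans t) s.polytabloid := by
    rw [tabloidRep_polytabloid]
    congr 1
    ext c
    simp
  have h3 : ∑ k', c k' * extend (f k') t.polytabloid x = 0 := by
    have := LinearMap.congr_fun hc (ρ (s.symm.trans t : Perm (Fin n))⁻¹ x)
    simpa only [ht, (hf _).extend_rep, LinearMap.sum_apply, LinearMap.smul_apply, smul_eq_mul,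
      LinearMap.zero_apply] using this
  rw [Finset.sum_eq_single k, (hf k).extend_polytabloid t hxt] at h3
  · exact (mul_eq_zero.1 h3).resolve_right (mul_ne_zero t.card_colStab_ne_zero h1)
  · intro k' _ hk'
    rw [(hf k').extend_polytabloid t hxt, h2 k' hk', mul_zero, mul_zero]
  · simp

/-- The column sum can be shifted to the vector by a formula that does not involve `f`, so a linear
relation among extended families survives the application of κ_t to all their arguments. -/
theorem IsTabloidFamily.extend_colSum {f : Tabloid n l → Module.Dual ℚ W}
    (hf : IsTabloidFamily ρ f) {l' : List ℕ} (t : Tableau n l') (y : Tabloid n l →₀ ℚ) (x : W) :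
    extend f (t.colSum l y) x =
      ∑ σ ∈ t.colStab, ((Perm.sign σ : ℤ) : ℚ) * extend f y (ρ σ⁻¹ x) := by
  simp only [Tableau.colSum, LinearMap.sum_apply, map_sum, LinearMap.smul_apply, map_smul,
    hf.extend_rep, smul_eq_mul]

theorem polytabloid_mem (t : Tableau n l) : t.polytabloid ∈ (spechtSub n l).toSubmodule :=
  Submodule.subset_span ⟨t, rfl⟩

theorem extend_sum_injective {L : List (ℕ × List ℕ)} (hs : ∀ p ∈ L, p.2.Pairwise (· ≥ ·))
    (hlex : L.Pairwise fun p q => ∃ k, (q.2.take k).sum < (p.2.take k).sum)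
    (f : ∀ a : Fin L.length, Fin (L.get a).1 → Tabloid n (L.get a).2 → Module.Dual ℚ W)
    (hf : ∀ a k, IsTabloidFamily ρ (f a k))
    (hx : ∀ a k, ∃ (t : Tableau n (L.get a).2) (x : W), IsColAlternating ρ t x ∧
      f a k t.tabloid x ≠ 0 ∧ ∀ k', k' ≠ k → f a k' t.tabloid x = 0)
    (y : ∀ a : Fin L.length, Fin (L.get a).1 → Tabloid n (L.get a).2 →₀ ℚ)
    (hy : ∀ a k, y a k ∈ (spechtSub n (L.get a).2).toSubmodule)
    (h0 : ∑ a, ∑ k, extend (f a k) (y a k) = 0) (a : Fin L.length) (k : Fin (L.get a).1) :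
    y a k = 0 := by
  classical
  by_contra hak
  let A : Finset (Fin L.length) := Finset.univ.filter fun a => ∃ k, y a k ≠ 0
  have hA : A.Nonempty := ⟨a, by simp only [A, Finset.mem_filter]; exact ⟨by simp, k, hak⟩⟩
  -- b is the last shape with a nonzero component. Later components vanish, and the shape of b
  -- dominates no earlier one, so κ_t kills everything outside b.
  obtain ⟨b, hbA, hmax⟩ : ∃ b ∈ A, ∀ c ∈ A, c ≤ b := ⟨A.max' hA, A.max'_mem hA, A.le_max'⟩
  obtain ⟨k₀, hk₀⟩ := (Finset.mem_filter.1 hbA).2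
  obtain ⟨t, ht⟩ := exists_colSum_ne_zero (hy b k₀) hk₀
  have hsort : (L.get b).2.Pairwise (· ≥ ·) := hs _ (L.get_mem b)
  choose c hc using fun k => t.exists_colSum_eq_smul hsort (y b k)
  have h1 : ∑ a, ∑ k, extend (f a k) (t.colSum _ (y a k)) = 0 := by
    ext x
    simp only [LinearMap.sum_apply, (hf _ _).extend_colSum, LinearMap.zero_apply]
    simp only [Finset.sum_comm (s := Finset.univ) (t := t.colStab), ← Finset.mul_sum]
    refine Finset.sum_eq_zero fun σ _ => ?_
    have := LinearMap.congr_fun h0 (ρ σ⁻¹ x)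
    simp only [LinearMap.sum_apply, LinearMap.zero_apply] at this
    rw [this, mul_zero]
  rw [Finset.sum_eq_single b] at h1
  · simp only [hc, map_smul] at h1
    apply ht
    rw [hc, extend_polytabloid_independent (hf b) (hx b) t c h1, zero_smul]
  · intro a _ hab
    refine Finset.sum_eq_zero fun k _ => ?_
    rcases lt_or_gt_of_ne hab with hlt | hlt
    · obtain ⟨j, hj⟩ := List.pairwise_iff_get.1 hlex a b hlt
      rw [t.colSum_eq_zero hsort hj, LinearMap.zero_apply, map_zero]
    · have : y a k = 0 := by
        by_contra hne
        have := hmax a (by simp only [A, Finset.mem_filter]; exact ⟨by simp, k, hne⟩)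
        exact absurd hlt this.not_gt
      rw [this, map_zero, map_zero]
  · simp

/-- The equivariant map to the Specht module given by a family of functionals. -/
def toSpecht (f : Tabloid n l → Module.Dual ℚ W) : W →ₗ[ℚ] (spechtSub n l).toSubmodule :=
  ∑ t : Tableau n l, (extend f t.polytabloid).smulRight ⟨t.polytabloid, polytabloid_mem t⟩

theorem toSpecht_apply (f : Tabloid n l → Module.Dual ℚ W) (x : W) :
    toSpecht f x = ∑ t : Tableau n l, extend f t.polytabloid x •
      (⟨t.polytabloid, polytabloid_mem t⟩ : (spechtSub n l).toSubmodule) := by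
  simp [toSpecht, LinearMap.sum_apply]

theorem IsTabloidFamily.toSpecht_rep {f : Tabloid n l → Module.Dual ℚ W}
    (hf : IsTabloidFamily ρ f) (π : Perm (Fin n)) (x : W) :
    toSpecht f (ρ π x) = specht n l π (toSpecht f x) := by
  rw [toSpecht_apply, toSpecht_apply, map_sum]
  refine (Fintype.sum_equiv (Equiv.mk (fun t : Tableau n l => t.trans π)
    (fun t => t.trans π.symm) (fun t => by ext; simp) (fun t => by ext; simp)) _ _ ?_).symm
  intro t
  rw [map_smul]
  have h : (specht n l π) ⟨t.polytabloid, polytabloid_mem t⟩ =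
      ⟨Tableau.polytabloid (t.trans π), polytabloid_mem _⟩ :=
    Subtype.ext (tabloidRep_polytabloid t π)
  have h' : extend f (Tableau.polytabloid (t.trans π)) (ρ π x) = extend f t.polytabloid x := by
    rw [← tabloidRep_polytabloid, hf.extend_apply]
  rw [h, Equiv.coe_fn_mk, h']

/-! ### From injectivity on the dual side to an equivariant isomorphism -/

theorem specht_hom_eq_zero (g : Module.Dual ℚ (spechtSub n l).toSubmodule)
    (h : ∀ t : Tableau n l, g ⟨t.polytabloid, polytabloid_mem t⟩ = 0) : g = 0 := by
  have key : ∀ y (hy : y ∈ (spechtSub n l).toSubmodule), g ⟨y, hy⟩ = 0 := by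
    intro y hy
    induction hy using Submodule.span_induction with
    | mem _ hx => obtain ⟨t, rfl⟩ := hx; exact h t
    | zero => exact map_zero g
    | add a b ha hb h1 h2 =>
      have := map_add g ⟨a, ha⟩ ⟨b, hb⟩
      rw [h1, h2, add_zero] at this
      exact this
    | smul c a ha h1 =>
      have := map_smul g c ⟨a, ha⟩
      rw [h1, smul_zero] at this
      exact this
  ext ⟨y, hy⟩
  exact key y hy

/-- A proper subspace lies in the kernel of a nonzero functional. Only an additive monoid is asked
of `E`; negatives come from the scalars. -/
theorem surjective_of_dual {E : Type*} [AddCommMonoid E] [Module ℚ E] (Ψ : W →ₗ[ℚ] E)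
    (h : ∀ g : Module.Dual ℚ E, (∀ x, g (Ψ x) = 0) → g = 0) : Function.Surjective Ψ := by
  let _ : AddCommGroup E := Module.addCommMonoidToAddCommGroup ℚ
  rw [← LinearMap.range_eq_top]
  by_contra hne
  obtain ⟨g, hg0, hg⟩ := Submodule.exists_le_ker_of_lt_top (LinearMap.range Ψ) (Ne.lt_top hne)
  exact hg0 (h g fun x => hg ⟨x, rfl⟩)

theorem injective_of_surjective_of_finrank_le {E : Type*} [AddCommMonoid E] [Module ℚ E]
    [FiniteDimensional ℚ W] (Ψ : W →ₗ[ℚ] E) (h : Function.Surjective Ψ)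
    (hE : Module.finrank ℚ W ≤ Module.finrank ℚ E) : Function.Injective Ψ := by
  let _ : AddCommGroup E := Module.addCommMonoidToAddCommGroup ℚ
  have := Module.Finite.of_surjective Ψ h
  exact (LinearMap.injective_iff_surjective_of_finrank_eq_finrank
    (hE.antisymm (LinearMap.finrank_le_finrank_of_surjective h))).2 h

/-- A representation that is no larger than a direct sum of Specht modules decomposes as this sum
if the shapes come in an order refining dominance and each is detected with its multiplicity. -/
theorem decomposesAs_of_detects [FiniteDimensional ℚ W] {L : List (ℕ × List ℕ)}
    (hs : ∀ p ∈ L, p.2.Pairwise (· ≥ ·))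
    (hlex : L.Pairwise fun p q => ∃ k, (q.2.take k).sum < (p.2.take k).sum)
    (hd : ∀ p ∈ L, Detects ρ p.2 p.1)
    (hdim : Module.finrank ℚ W ≤
      (L.map fun p => p.1 * Module.finrank ℚ (spechtSub n p.2).toSubmodule).sum) :
    DecomposesAs ρ L := by
  classical
  choose f hf hx using fun a : Fin L.length => hd _ (L.get_mem a)
  let V := fun i : (Σ a : Fin L.length, Fin (L.get a).1) => (spechtSub n (L.get i.1).2).toSubmodule
  let Ψ : W →ₗ[ℚ] DirectSum _ fun i => V i :=
    ∑ i : (Σ a : Fin L.length, Fin (L.get a).1),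
      DirectSum.lof ℚ _ (fun i => V i) i ∘ₗ toSpecht (f i.1 i.2)
  have hΨ : ∀ x, Ψ x = ∑ i : (Σ a : Fin L.length, Fin (L.get a).1),
      DirectSum.lof ℚ _ (fun i => V i) i (toSpecht (f i.1 i.2) x) := by
    intro x
    simp only [Ψ, LinearMap.sum_apply, LinearMap.comp_apply]
  have hequiv : ∀ π x, Ψ (ρ π x) = Representation.directSum
      (fun i : (Σ a : Fin L.length, Fin (L.get a).1) => specht n (L.get i.1).2) π (Ψ x) := by
    intro π x
    rw [hΨ, hΨ, map_sum]
    refine Finset.sum_congr rfl fun i _ => ?_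
    rw [(hf i.1 i.2).toSpecht_rep]
    exact (DirectSum.lmap_lof (R := ℚ) (fun i : (Σ a : Fin L.length, Fin (L.get a).1) =>
      specht n (L.get i.1).2 π) i (toSpecht (f i.1 i.2) x)).symm
  have hsurj : Function.Surjective Ψ := by
    refine surjective_of_dual Ψ fun g hg => ?_
    -- The element ∑ g(e_t) e_t is chosen because pairing it with the families recovers g ∘ Ψ = 0,
    -- while g takes the value ∑ g(e_t)² on it. Injectivity gives y = 0, and then every g(e_t)
    -- vanishes.
    let y : ∀ a : Fin L.length, Fin (L.get a).1 → Tabloid n (L.get a).2 →₀ ℚ := fun a k =>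
      ∑ t : Tableau n (L.get a).2, g (DirectSum.lof ℚ _ (fun i => V i) ⟨a, k⟩
        ⟨t.polytabloid, polytabloid_mem t⟩) • t.polytabloid
    have hmem : ∀ a k, y a k ∈ (spechtSub n (L.get a).2).toSubmodule := fun a k =>
      Submodule.sum_mem _ fun t _ => Submodule.smul_mem _ _ (polytabloid_mem t)
    have hy := extend_sum_injective hs hlex f hf hx y hmem (by
      ext x
      have h1 : g (Ψ x) = 0 := hg x
      rw [hΨ, map_sum, Fintype.sum_sigma] at h1
      rw [LinearMap.zero_apply, ← h1, LinearMap.sum_apply]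
      refine Finset.sum_congr rfl fun a _ => ?_
      rw [LinearMap.sum_apply]
      refine Finset.sum_congr rfl fun k _ => ?_
      rw [toSpecht_apply]
      simp only [y, map_sum, map_smul, LinearMap.sum_apply, LinearMap.smul_apply, smul_eq_mul]
      exact Finset.sum_congr rfl fun t _ => mul_comm _ _)
    refine DirectSum.linearMap_ext ℚ fun i => ?_
    obtain ⟨a, k⟩ := i
    rw [LinearMap.zero_comp]
    refine specht_hom_eq_zero (n := n) _ fun t => ?_
    have h2 : g (DirectSum.lof ℚ _ (fun i => V i) ⟨a, k⟩ ⟨y a k, hmem a k⟩) = 0 := by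
      have : (⟨y a k, hmem a k⟩ : V ⟨a, k⟩) = 0 := Subtype.ext (hy a k)
      rw [this, map_zero, map_zero]
    have h3 : (⟨y a k, hmem a k⟩ : V ⟨a, k⟩) = ∑ t : Tableau n (L.get a).2,
        g (DirectSum.lof ℚ _ (fun i => V i) ⟨a, k⟩ ⟨t.polytabloid, polytabloid_mem t⟩) •
          (⟨t.polytabloid, polytabloid_mem t⟩ : V ⟨a, k⟩) := by
      apply Subtype.ext
      simp [y]
    rw [h3] at h2
    simp only [map_sum, map_smul, smul_eq_mul] at h2
    rw [Finset.sum_eq_zero_iff_of_nonneg fun t _ => mul_self_nonneg _] at h2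
    exact mul_self_eq_zero.1 (h2 t (Finset.mem_univ t))
  have hfin : Module.finrank ℚ W ≤ Module.finrank ℚ (DirectSum _ fun i => V i) := by
    refine hdim.trans (le_of_eq ?_)
    rw [Module.finrank_directSum, Fintype.sum_sigma, ← Fin.sum_univ_fun_getElem]
    refine Finset.sum_congr rfl fun a _ => ?_
    exact (Fintype.sum_congr _ (fun _ => Module.finrank ℚ (spechtSub n (L.get a).2).toSubmodule)
      fun _ => rfl).trans (by simp) |>.symm
  have hinj : Function.Injective Ψ := injective_of_surjective_of_finrank_le Ψ hsurj hfin
  exact ⟨Representation.Equiv.mk (LinearEquiv.ofBijective Ψ ⟨hinj, hsurj⟩) fun π => by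
    ext1 x
    exact hequiv π x⟩

end Criterion

/-! ### Standard tableaux and the dimension of Specht modules -/

section Standard

variable {n : ℕ} {l : List ℕ}

/-- The entries of the columns of `t` increase. -/
def Tableau.IsColStrict (t : Tableau n l) : Prop :=
  ∀ x y, t.col x = t.col y → t.row x < t.row y → x < y

/-- Look at the least z that σ⁻¹ moves: smaller entries keep their rows. If σ⁻¹ z stood above z in
the column, it would be smaller than z, hence fixed, which is absurd; so the row of z goes up. -/
theorem Tableau.IsColStrict.lt_smul {t : Tableau n l} (ht : t.IsColStrict) {σ : Perm (Fin n)}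
    (hσ : σ ∈ t.colStab) (h1 : σ ≠ 1) : toLex t.row < toLex (σ • t.tabloid).row := by
  have hσ' := Tableau.mem_colStab.1 (Tableau.inv_mem_colStab hσ)
  have hex : ∃ z, σ⁻¹ z ≠ z := by
    by_contra! h
    exact h1 (inv_eq_one.1 (Equiv.ext h))
  obtain ⟨z, hz, hmin⟩ := WellFounded.has_min (wellFounded_lt (α := Fin n)) {z | σ⁻¹ z ≠ z} hex
  have hfix : ∀ y, y < z → σ⁻¹ y = y := fun y hy => by_contra fun h => hmin y h hy
  refine ⟨z, fun y hy => ?_, ?_⟩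
  · change t.row y = t.row (σ⁻¹ y)
    rw [hfix y hy]
  · change t.row z < t.row (σ⁻¹ z)
    rcases lt_trichotomy (t.row z) (t.row (σ⁻¹ z)) with h | h | h
    · exact h
    · exact absurd (t.ext_row_col h (hσ' z).symm).symm hz
    · exact absurd ((σ⁻¹).injective (hfix _ (ht _ _ (hσ' z) h))) hz

theorem Tableau.IsColStrict.polytabloid_apply_self {t : Tableau n l} (ht : t.IsColStrict) :
    t.polytabloid t.tabloid = 1 := by
  classical
  rw [Tableau.polytabloid, Finsupp.finsetSum_apply, Finset.sum_eq_single 1]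
  · simp
  · intro σ hσ h1
    rw [Finsupp.single_apply, if_neg]
    intro h
    have := ht.lt_smul hσ h1
    rw [h] at this
    exact lt_irrefl _ this
  · exact fun h => absurd t.one_mem_colStab h

theorem Tableau.IsColStrict.le_of_polytabloid_apply_ne_zero {t : Tableau n l}
    (ht : t.IsColStrict) {T : Tabloid n l} (hT : t.polytabloid T ≠ 0) :
    toLex t.row ≤ toLex T.row := by
  classical
  rw [Tableau.polytabloid, Finsupp.finsetSum_apply] at hT
  obtain ⟨σ, hσ, h⟩ := Finset.exists_ne_zero_of_sum_ne_zero hT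
  rw [Finsupp.single_apply, ne_eq, ite_eq_right_iff, Classical.not_imp] at h
  rw [← h.1]
  rcases eq_or_ne σ 1 with rfl | h1
  · exact le_rfl
  · exact (ht.lt_smul hσ h1).le

/-- The tabloid of a column strict tableau is the lexicographically least term of its polytabloid
and has coefficient 1. Distinct tabloids therefore give independent polytabloids; a relation is
refuted at the least leading tabloid that occurs in it. -/
theorem card_le_finrank_of_isColStrict {ι : Type} [Fintype ι] (t : ι → Tableau n l)
    (ht : ∀ i, (t i).IsColStrict) (hinj : Function.Injective fun i => (t i).row) :
    Fintype.card ι ≤ Module.finrank ℚ (spechtSub n l).toSubmodule := by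
  classical
  have hli : LinearIndependent ℚ fun i => (t i).polytabloid := by
    rw [Fintype.linearIndependent_iff]
    by_contra! h
    obtain ⟨g, hg, i₀, hi₀⟩ := h
    obtain ⟨i, hi, hmin⟩ := Finset.exists_min_image (Finset.univ.filter fun i => g i ≠ 0)
      (fun i => toLex (t i).row) ⟨i₀, by simpa using hi₀⟩
    have h1 := DFunLike.congr_fun hg (t i).tabloid
    rw [Finsupp.finsetSum_apply, Finset.sum_eq_single i] at h1
    · rw [Finsupp.smul_apply, (ht i).polytabloid_apply_self] at h1
      simp only [Finset.mem_filter, Finset.mem_univ, true_and] at hi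
      exact hi (by simpa using h1)
    · intro j _ hji
      rw [Finsupp.smul_apply]
      by_contra hne
      have hj : g j ≠ 0 := fun h => hne (by rw [h, zero_smul])
      have h2 := (ht j).le_of_polytabloid_apply_ne_zero (T := (t i).tabloid)
        fun h => hne (by rw [h, smul_zero])
      have h3 := hmin j (by simpa using hj)
      exact hji (hinj (toLex.injective (le_antisymm h2 h3)))
    · simp
  have hli' : LinearIndependent ℚ fun i =>
      (⟨(t i).polytabloid, polytabloid_mem (t i)⟩ : (spechtSub n l).toSubmodule) :=
    LinearIndependent.of_comp (Submodule.subtype _) hli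
  exact hli'.fintype_card_le_finrank

/-- Every initial segment of the word `r` contains each letter at least as often as the
larger letters. -/
def IsBallot (r : Fin n → ℕ) : Prop :=
  ∀ k : ℕ, Antitone fun i => (Finset.univ.filter fun x : Fin n => (x : ℕ) < k ∧ r x = i).card

/-- Put x in row r x, in the column counted by the earlier occurrences of that letter. The ballot
condition is what makes columns increase. -/
theorem exists_isColStrict {r : Fin n → ℕ}
    (hr : ∀ i, (Finset.univ.filter fun x => r x = i).card = l.getD i 0) (hb : IsBallot r) :
    ∃ t : Tableau n l, t.IsColStrict ∧ ∀ x, (t.row x : ℕ) = r x := by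
  have hlen : ∀ x, r x < l.length := by
    intro x
    by_contra h
    have h1 := hr (r x)
    rw [List.getD_eq_default _ _ (by omega), Finset.card_eq_zero] at h1
    exact Finset.notMem_empty x (h1 ▸ by simp)
  let rk : Fin n → ℕ := fun x => (Finset.univ.filter fun y : Fin n => (y : ℕ) < x ∧ r y = r x).card
  have hmono : ∀ x y, r x = r y → x < y → rk x < rk y := by
    intro x y hxy hlt
    refine Finset.card_lt_card ?_
    rw [Finset.ssubset_iff_of_subset]
    · exact ⟨x, by simp [hxy, hlt], by simp⟩
    · intro z hz
      simp only [Finset.mem_filter, Finset.mem_univ, true_and] at hz ⊢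
      exact ⟨hz.1.trans hlt, hz.2.trans hxy⟩
  have hrk : ∀ x, rk x < l.get ⟨r x, hlen x⟩ := by
    intro x
    have h1 := hr (r x)
    rw [List.getD_eq_getElem _ _ (hlen x)] at h1
    rw [List.get_eq_getElem, ← h1]
    refine Finset.card_lt_card ?_
    rw [Finset.ssubset_iff_of_subset]
    · exact ⟨x, by simp, by simp⟩
    · intro z hz
      simp only [Finset.mem_filter, Finset.mem_univ, true_and] at hz ⊢
      exact hz.2
  let f : Fin n → Cell l := fun x => ⟨⟨r x, hlen x⟩, ⟨rk x, hrk x⟩⟩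
  have hf : Function.Injective f := by
    intro x y hxy
    have h1 : r x = r y := congrArg (fun c : Cell l => (c.1 : ℕ)) hxy
    have h2 : rk x = rk y := congrArg (fun c : Cell l => (c.2 : ℕ)) hxy
    rcases lt_trichotomy x y with h | h | h
    · exact absurd h2 (hmono x y h1 h).ne
    · exact h
    · exact absurd h2 (hmono y x h1.symm h).ne'
  have hcard : Fintype.card (Fin n) = Fintype.card (Cell l) := by
    have h1 := card_lt_eq_sum_take hr l.length
    rw [List.take_length, Finset.filter_true_of_mem fun x _ => hlen x, Finset.card_univ] at h1
    rw [h1, Fintype.card_sigma, ← Fin.sum_univ_getElem]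
    simp
  have hbij := (Fintype.bijective_iff_injective_and_card f).2 ⟨hf, hcard⟩
  refine ⟨(Equiv.ofBijective f hbij).symm, ?_, fun x => rfl⟩
  intro x y hc hrow
  replace hc : rk x = rk y := hc
  replace hrow : r x < r y := hrow
  by_contra hxy
  have hne : y ≠ x := by rintro rfl; exact lt_irrefl _ hrow
  have hyx : y < x := lt_of_le_of_ne (not_lt.1 hxy) hne
  -- If y < x share a column with y in the lower row, the prefix ending at y contains more letters r
  -- y than r x although r x < r y.
  have h1 := hb (y + 1) hrow.le
  have h2 : (Finset.univ.filter fun z : Fin n => (z : ℕ) < y + 1 ∧ r z = r x).card ≤ rk x := by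
    refine Finset.card_le_card fun z hz => ?_
    simp only [Finset.mem_filter, Finset.mem_univ, true_and] at hz ⊢
    have : (y : ℕ) < x := hyx
    exact ⟨by omega, hz.2⟩
  have h3 : rk y < (Finset.univ.filter fun z : Fin n => (z : ℕ) < y + 1 ∧ r z = r y).card := by
    refine Finset.card_lt_card ?_
    rw [Finset.ssubset_iff_of_subset]
    · exact ⟨y, by simp, by simp⟩
    · intro z hz
      simp only [Finset.mem_filter, Finset.mem_univ, true_and] at hz ⊢
      exact ⟨by omega, hz.2⟩
  simp only at h1
  omega

/-- There are at least `N` ballot words of length `n` in which the letter `i` occurs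
`c i` times. -/
def HasBallotWords (n : ℕ) (c : ℕ → ℕ) (N : ℕ) : Prop :=
  ∃ S : Finset (Fin n → ℕ), S.card = N ∧
    ∀ r ∈ S, (∀ i, (Finset.univ.filter fun x => r x = i).card = c i) ∧ IsBallot r

theorem HasBallotWords.le_finrank {N : ℕ} (h : HasBallotWords n (fun i => l.getD i 0) N) :
    N ≤ Module.finrank ℚ (spechtSub n l).toSubmodule := by
  obtain ⟨S, rfl, hS⟩ := h
  choose t ht hrow using fun r : S => exists_isColStrict (hS r r.2).1 (hS r r.2).2
  rw [← Fintype.card_coe]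
  refine card_le_finrank_of_isColStrict t ht fun r s hrs => ?_
  apply Subtype.ext
  funext x
  rw [← hrow r, ← hrow s]
  exact congrArg Fin.val (congrFun hrs x)

theorem hasBallotWords_zero (n : ℕ) (c : ℕ → ℕ) : HasBallotWords n c 0 :=
  ⟨∅, rfl, by simp⟩

theorem card_filter_snoc (r : Fin n → ℕ) (i j : ℕ) :
    (Finset.univ.filter fun x => (Fin.snoc r i : Fin (n + 1) → ℕ) x = j).card =
      (Finset.univ.filter fun x => r x = j).card + if i = j then 1 else 0 := by
  simp only [Finset.card_filter, Fin.sum_univ_castSucc, Fin.snoc_castSucc, Fin.snoc_last]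

theorem IsBallot.snoc {r : Fin n → ℕ} (hr : IsBallot r) (i : ℕ)
    (h : Antitone fun j => (Finset.univ.filter fun x =>
      (Fin.snoc r i : Fin (n + 1) → ℕ) x = j).card) :
    IsBallot (Fin.snoc r i : Fin (n + 1) → ℕ) := by
  intro k
  by_cases hk : k ≤ n
  · convert hr k using 2 with j
    simp only [Finset.card_filter, Fin.sum_univ_castSucc, Fin.snoc_castSucc, Fin.snoc_last,
      Fin.val_castSucc, Fin.val_last, hk.not_gt, false_and, if_false, add_zero]
  · convert h using 4 with j x
    have := x.2
    simp only [and_iff_right_iff_imp]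
    intro _
    omega

/-- Words are sorted by their last letter, which keeps the classes disjoint. Appending a letter
creates one new prefix, the full word, and there the ballot condition is the monotonicity of `c`. -/
theorem HasBallotWords.sum {c : ℕ → ℕ} (hc : Antitone c) (I : Finset ℕ) (N : ℕ → ℕ)
    (h : ∀ i ∈ I, ∃ c', HasBallotWords n c' (N i) ∧ ∀ j, c j = c' j + if i = j then 1 else 0) :
    HasBallotWords (n + 1) c (∑ i ∈ I, N i) := by
  classical
  choose! c' hw hc' using h
  choose! S hN hS using hw
  have hinj : ∀ i, Function.Injective fun r : Fin n → ℕ => (Fin.snoc r i : Fin (n + 1) → ℕ) := by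
    intro i r s hrs
    funext x
    simpa using congrFun hrs x.castSucc
  refine ⟨I.biUnion fun i => (S i).image fun r => Fin.snoc r i, ?_, ?_⟩
  · rw [Finset.card_biUnion]
    · refine Finset.sum_congr rfl fun i hi => ?_
      rw [Finset.card_image_of_injective _ (hinj i), hN i hi]
    · intro i _ j _ hij
      rw [Function.onFun, Finset.disjoint_left]
      intro u hu hu'
      obtain ⟨r, _, rfl⟩ := Finset.mem_image.1 hu
      obtain ⟨s, _, hs⟩ := Finset.mem_image.1 hu'
      have := congrFun hs (Fin.last n)
      simp only [Fin.snoc_last] at this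
      exact hij this.symm
  · intro u hu
    obtain ⟨i, hi, hu⟩ := Finset.mem_biUnion.1 hu
    obtain ⟨r, hr, rfl⟩ := Finset.mem_image.1 hu
    have h1 : ∀ j, (Finset.univ.filter fun x => (Fin.snoc r i : Fin (n + 1) → ℕ) x = j).card =
        c j := by
      intro j
      rw [card_filter_snoc, (hS i hi r hr).1, hc' i hi]
    refine ⟨h1, (hS i hi r hr).2.snoc i ?_⟩
    simpa only [h1] using hc

/-- There are at least `N` ballot words with `a`, `b`, `d` letters `0`, `1`, `2`. -/
def HasBallotWords₃ (a b d N : ℕ) : Prop :=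
  HasBallotWords (a + b + d) (fun i => [a, b, d].getD i 0) N

theorem antitone_getD {a b d : ℕ} (hb : b ≤ a) (hd : d ≤ b) :
    Antitone fun i => [a, b, d].getD i 0 := by
  refine antitone_nat_of_succ_le fun i => ?_
  rcases i with _ | _ | _ | i <;> simp [hb, hd]

theorem hasBallotWords₃_zero (a b d : ℕ) : HasBallotWords₃ a b d 0 :=
  hasBallotWords_zero _ _

theorem HasBallotWords₃.step₁ {a N : ℕ} (h : HasBallotWords₃ a 0 0 N) :
    HasBallotWords₃ (a + 1) 0 0 N := by
  have := HasBallotWords.sum (n := a + 0 + 0) (antitone_getD (Nat.zero_le (a + 1)) le_rfl) {0}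
    (fun _ => N) (by
      intro i hi
      rw [Finset.mem_singleton] at hi
      subst hi
      refine ⟨_, h, fun j => ?_⟩
      rcases j with _ | _ | _ | j <;> simp)
  simpa using! this

/-- The branching rule: the last letter marks the corner that is removed. For a = b the shape (a, b
+ 1) is no partition, and its term has to be supplied with N = 0. -/
theorem HasBallotWords₃.step₂ {a b N M : ℕ} (hab : b ≤ a) (h : HasBallotWords₃ a (b + 1) 0 N)
    (h' : HasBallotWords₃ (a + 1) b 0 M) : HasBallotWords₃ (a + 1) (b + 1) 0 (N + M) := by
  have e : a + 1 + b + 0 = a + (b + 1) + 0 := by omega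
  have e' : a + 1 + (b + 1) + 0 = a + (b + 1) + 0 + 1 := by omega
  unfold HasBallotWords₃ at *
  rw [e] at h'
  rw [e']
  have := HasBallotWords.sum (antitone_getD (Nat.succ_le_succ hab) (Nat.zero_le (b + 1))) {0, 1}
    (fun i => if i = 0 then N else M) (by
      intro i hi
      rw [Finset.mem_insert, Finset.mem_singleton] at hi
      rcases hi with rfl | rfl
      · refine ⟨_, h, fun j => ?_⟩
        rcases j with _ | _ | _ | j <;> simp
      · refine ⟨_, h', fun j => ?_⟩
        rcases j with _ | _ | _ | j <;> simp)
  simpa using! this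

theorem HasBallotWords₃.step₃ {a b d N M P : ℕ} (hab : b ≤ a) (hbd : d ≤ b)
    (h : HasBallotWords₃ a (b + 1) (d + 1) N) (h' : HasBallotWords₃ (a + 1) b (d + 1) M)
    (h'' : HasBallotWords₃ (a + 1) (b + 1) d P) :
    HasBallotWords₃ (a + 1) (b + 1) (d + 1) (N + M + P) := by
  have e : a + 1 + b + (d + 1) = a + (b + 1) + (d + 1) := by omega
  have e' : a + 1 + (b + 1) + d = a + (b + 1) + (d + 1) := by omega
  have e'' : a + 1 + (b + 1) + (d + 1) = a + (b + 1) + (d + 1) + 1 := by omega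
  unfold HasBallotWords₃ at *
  rw [e] at h'
  rw [e'] at h''
  rw [e'']
  have := HasBallotWords.sum (antitone_getD (Nat.succ_le_succ hab) (Nat.succ_le_succ hbd))
    {0, 1, 2} (fun i => if i = 0 then N else if i = 1 then M else P) (by
      intro i hi
      rw [Finset.mem_insert, Finset.mem_insert, Finset.mem_singleton] at hi
      rcases hi with rfl | rfl | rfl
      · refine ⟨_, h, fun j => ?_⟩
        rcases j with _ | _ | _ | j <;> simp
      · refine ⟨_, h', fun j => ?_⟩
        rcases j with _ | _ | _ | j <;> simp
      · refine ⟨_, h'', fun j => ?_⟩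
        rcases j with _ | _ | _ | j <;> simp)
  simpa [add_assoc] using! this

/-! ### Numbers of standard tableaux for the shapes that occur -/

theorem hasBallotWords₃_one_row (a : ℕ) : HasBallotWords₃ a 0 0 1 := by
  induction a with
  | zero =>
    refine ⟨{fun x => x.elim0}, rfl, fun r _ => ⟨fun i => ?_, fun k i j _ => ?_⟩⟩
    · rcases i with _ | _ | _ | i <;> simp
    · simp
  | succ a ih => exact ih.step₁

theorem hasBallotWords₃_one (a : ℕ) : HasBallotWords₃ a 1 0 a := by
  induction a with
  | zero => exact hasBallotWords₃_zero _ _ _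
  | succ a ih => exact ih.step₂ (Nat.zero_le a) (hasBallotWords₃_one_row _)

/-- The number is n(n − 3)/2 with n = k + 3. Here and in the counts below, k = 0 is the first shape
that fails to be a partition, where the closed formula vanishes and starts the induction;
denominators are cleared to stay in ℕ. -/
theorem exists_hasBallotWords₃_two (k : ℕ) :
    ∃ N, HasBallotWords₃ (k + 1) 2 0 N ∧ 2 * N = (k + 3) * k := by
  induction k with
  | zero => exact ⟨0, hasBallotWords₃_zero _ _ _, rfl⟩
  | succ k ih =>
    obtain ⟨N, hN, h⟩ := ih
    exact ⟨_, hN.step₂ (by omega) (hasBallotWords₃_one _), by linarith⟩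

theorem exists_hasBallotWords₃_three (k : ℕ) :
    ∃ N, HasBallotWords₃ (k + 2) 3 0 N ∧ 6 * N = (k + 5) * (k + 4) * k := by
  induction k with
  | zero => exact ⟨0, hasBallotWords₃_zero _ _ _, rfl⟩
  | succ k ih =>
    obtain ⟨N, hN, h⟩ := ih
    obtain ⟨M, hM, h'⟩ := exists_hasBallotWords₃_two (k + 2)
    exact ⟨_, hN.step₂ (by omega) hM, by linarith⟩

theorem exists_hasBallotWords₃_one_one (k : ℕ) :
    ∃ N, HasBallotWords₃ k 1 1 N ∧ 2 * N = k * (k + 1) := by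
  induction k with
  | zero => exact ⟨0, hasBallotWords₃_zero _ _ _, rfl⟩
  | succ k ih =>
    obtain ⟨N, hN, h⟩ := ih
    -- The predecessor (k + 1, 0, 1) is not a partition and contributes zero.
    exact ⟨_, hN.step₃ (by omega) le_rfl (hasBallotWords₃_zero _ _ _) (hasBallotWords₃_one _),
      by linarith⟩

theorem exists_hasBallotWords₃_two_one (k : ℕ) :
    ∃ N, HasBallotWords₃ (k + 1) 2 1 N ∧ 3 * N = (k + 4) * (k + 2) * k := by
  induction k with
  | zero => exact ⟨0, hasBallotWords₃_zero _ _ _, rfl⟩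
  | succ k ih =>
    obtain ⟨N, hN, h⟩ := ih
    obtain ⟨M, hM, h'⟩ := exists_hasBallotWords₃_one_one (k + 2)
    obtain ⟨P, hP, h''⟩ := exists_hasBallotWords₃_two (k + 1)
    exact ⟨_, hN.step₃ (by omega) (by omega) hM hP, by linarith⟩

theorem exists_hasBallotWords₃_three_one (k : ℕ) :
    ∃ N, HasBallotWords₃ (k + 2) 3 1 N ∧ 8 * N = (k + 6) * (k + 5) * (k + 3) * k := by
  induction k with
  | zero => exact ⟨0, hasBallotWords₃_zero _ _ _, rfl⟩
  | succ k ih =>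
    obtain ⟨N, hN, h⟩ := ih
    obtain ⟨M, hM, h'⟩ := exists_hasBallotWords₃_two_one (k + 2)
    obtain ⟨P, hP, h''⟩ := exists_hasBallotWords₃_three (k + 1)
    exact ⟨_, hN.step₃ (by omega) (by omega) hM hP, by linarith⟩

theorem HasBallotWords₃.le_finrank {a b d N : ℕ} (h : HasBallotWords₃ a b d N)
    (hn : n = a + b + d) (hl : ∀ i, l.getD i 0 = [a, b, d].getD i 0) :
    N ≤ Module.finrank ℚ (spechtSub n l).toSubmodule := by
  subst hn
  apply HasBallotWords.le_finrank
  simpa only [hl] using! h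

end Standard

/-! ### Generators of the Arnold algebra and linear functionals -/

section Functionals

variable {n : ℕ}

/-- The generator of the Arnold algebra attached to an unordered pair. -/
def edgeGen (e : Gen n) : Alg n := proj n (ExteriorAlgebra.ι ℚ (Finsupp.single e 1))

/-- The generator `w_{ij}` of the Arnold algebra, with value zero for `i = j`. -/
def gen (i j : Fin n) : Alg n := if h : i ≠ j then proj n (w i j h) else 0

theorem gen_eq_edgeGen {i j : Fin n} (h : i ≠ j) :
    gen i j = edgeGen ⟨s(i, j), by simpa using h⟩ := dif_pos h

theorem gen_of_ne {i j : Fin n} (h : i ≠ j) : gen i j = proj n (w i j h) := dif_pos h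

theorem gen_symm (i j : Fin n) : gen i j = gen j i := by
  by_cases h : i = j
  · rw [h]
  · rw [gen_of_ne h, gen_of_ne (Ne.symm h), w_symm]

theorem gen_self (i : Fin n) : gen i i = 0 := dif_neg (by simp)

theorem act_gen (π : Perm (Fin n)) (i j : Fin n) : act π (gen i j) = gen (π i) (π j) := by
  by_cases h : i = j
  · rw [h, gen_self, gen_self, map_zero]
  · rw [gen_of_ne h, gen_of_ne (π.injective.ne h), act_proj, extAct_w]

theorem act_edgeGen (π : Perm (Fin n)) (e : Gen n) :
    act π (edgeGen e) = edgeGen (permGen π e) := by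
  rw [edgeGen, act_proj, extAct, ExteriorAlgebra.map_apply_ι, Finsupp.lmapDomain_apply,
    Finsupp.mapDomain_single, edgeGen]

theorem gen_anticomm (i j k l : Fin n) : gen i j * gen k l = -(gen k l * gen i j) := by
  by_cases h : i = j
  · rw [h, gen_self]; simp
  · by_cases h' : k = l
    · rw [h', gen_self]; simp
    · rw [gen_of_ne h, gen_of_ne h', ← map_mul, w_anticomm, map_neg, map_mul]

theorem edgeGen_mul_self (e : Gen n) : edgeGen e * edgeGen e = 0 := by
  rw [edgeGen, ← map_mul, ExteriorAlgebra.ι_sq_zero, map_zero]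

theorem gen_relation {i j k : Fin n} (hij : i ≠ j) (hik : i ≠ k) (hjk : j ≠ k) :
    gen i j * gen i k - gen i j * gen j k + gen i k * gen j k = 0 := by
  rw [gen_of_ne hij, gen_of_ne hik, gen_of_ne hjk]
  simpa [yb] using proj_yb i j k hij hik hjk

theorem exists_edgeGen_eq (e : Gen n) : ∃ i j : Fin n, i < j ∧ edgeGen e = gen i j := by
  obtain ⟨e, he⟩ := e
  induction e using Sym2.ind with
  | _ i j =>
    have h : i ≠ j := by simpa using he
    rcases lt_or_gt_of_ne h with h' | h'
    · exact ⟨i, j, h', (gen_eq_edgeGen h).symm⟩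
    · exact ⟨j, i, h', by rw [gen_symm, gen_eq_edgeGen h]⟩

theorem component_one_eq_span :
    (component n 1).toSubmodule = Submodule.span ℚ (Set.range (edgeGen (n := n))) := by
  have h1 : LinearMap.range (ExteriorAlgebra.ι ℚ : (Gen n →₀ ℚ) →ₗ[ℚ] Ext n) =
      Submodule.span ℚ (Set.range fun e : Gen n => ExteriorAlgebra.ι ℚ (Finsupp.single e 1)) := by
    rw [LinearMap.range_eq_map, ← Finsupp.basisSingleOne.span_eq, Submodule.map_span,
      Finsupp.coe_basisSingleOne, ← Set.range_comp]
    rfl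
  change Submodule.map (proj n).toLinearMap (LinearMap.range (ExteriorAlgebra.ι ℚ) ^ 1) = _
  rw [pow_one, h1, Submodule.map_span, ← Set.range_comp]
  rfl

theorem component_two_eq_mul :
    (component n 2).toSubmodule = (component n 1).toSubmodule * (component n 1).toSubmodule := by
  change Submodule.map (proj n).toLinearMap (LinearMap.range (ExteriorAlgebra.ι ℚ) ^ 2) =
    Submodule.map (proj n).toLinearMap (LinearMap.range (ExteriorAlgebra.ι ℚ) ^ 1) *
    Submodule.map (proj n).toLinearMap (LinearMap.range (ExteriorAlgebra.ι ℚ) ^ 1)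
  rw [pow_one, pow_two, Submodule.map_mul]

theorem component_two_eq_span :
    (component n 2).toSubmodule =
      Submodule.span ℚ (Set.range fun p : Gen n × Gen n => edgeGen p.1 * edgeGen p.2) := by
  rw [component_two_eq_mul, component_one_eq_span, Submodule.span_mul_span]
  congr 1
  ext x
  simp [Set.mem_mul]

theorem gen_mem (i j : Fin n) : gen i j ∈ (component n 1).toSubmodule := by
  by_cases h : i = j
  · rw [h, gen_self]; exact Submodule.zero_mem _
  · rw [gen_eq_edgeGen h, component_one_eq_span]
    exact Submodule.subset_span ⟨_, rfl⟩

theorem mul_mem_component_two {x y : Alg n} (hx : x ∈ (component n 1).toSubmodule)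
    (hy : y ∈ (component n 1).toSubmodule) : x * y ∈ (component n 2).toSubmodule := by
  rw [component_two_eq_mul]
  exact Submodule.mul_mem_mul hx hy

/-! ### Upper bounds for the dimensions -/

theorem component_one_le_span :
    (component n 1).toSubmodule ≤ Submodule.span ℚ (Set.range
      fun p : (Σ j : Fin n, Fin j) => gen (p.2.castLE p.1.2.le) p.1) := by
  rw [component_one_eq_span, Submodule.span_le]
  rintro _ ⟨e, rfl⟩
  obtain ⟨i, j, hij, h⟩ := exists_edgeGen_eq e
  rw [h]
  exact Submodule.subset_span ⟨⟨j, ⟨i, hij⟩⟩, rfl⟩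

/-- Monomials with distinct larger endpoints suffice: anticommutativity orders these endpoints, and
the braid relation removes the products in which they coincide. -/
theorem component_two_le_span :
    (component n 2).toSubmodule ≤ Submodule.span ℚ (Set.range
      fun p : (Σ l : Fin n, Σ j : Fin l, Fin j × Fin l) =>
        gen (p.2.2.1.castLE (p.2.1.2.trans p.1.2).le) (p.2.1.castLE p.1.2.le) *
          gen (p.2.2.2.castLE p.1.2.le) p.1) := by
  set M := Submodule.span ℚ (Set.range
      fun p : (Σ l : Fin n, Σ j : Fin l, Fin j × Fin l) =>
        gen (p.2.2.1.castLE (p.2.1.2.trans p.1.2).le) (p.2.1.castLE p.1.2.le) *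
          gen (p.2.2.2.castLE p.1.2.le) p.1) with hM
  have key : ∀ i j k l : Fin n, i < j → k < l → j < l → gen i j * gen k l ∈ M :=
    fun i j k l hij hkl hjl => Submodule.subset_span
      ⟨⟨l, ⟨⟨j, hjl⟩, ⟨⟨i, hij⟩, ⟨k, hkl⟩⟩⟩⟩, rfl⟩
  -- For i < k < j the relation reads w_ij w_kj = w_ik w_kj − w_ik w_ij, and both products on the
  -- right have larger endpoints k < j.
  have key' : ∀ i k j : Fin n, i < k → k < j → gen i j * gen k j ∈ M := by
    intro i k j hik hkj
    have h := gen_relation hik.ne (hik.trans hkj).ne hkj.ne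
    have h' : gen i j * gen k j = gen i k * gen k j - gen i k * gen i j := by
      rw [← sub_eq_zero, ← h]
      abel
    rw [h']
    exact Submodule.sub_mem _ (key _ _ _ _ hik hkj hkj) (key _ _ _ _ hik (hik.trans hkj) hkj)
  rw [component_two_eq_span, Submodule.span_le]
  rintro _ ⟨⟨e, f⟩, rfl⟩
  obtain ⟨i, j, hij, he⟩ := exists_edgeGen_eq e
  obtain ⟨k, l, hkl, hf⟩ := exists_edgeGen_eq f
  simp only [he, hf]
  rcases lt_trichotomy j l with h | rfl | h
  · exact key i j k l hij hkl h
  · rcases lt_trichotomy i k with h | rfl | h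
    · exact key' i k j h hkl
    · have h2 : gen i j * gen i j = 0 := by rw [← he, edgeGen_mul_self]
      rw [h2]
      exact Submodule.zero_mem _
    · rw [gen_anticomm]
      exact Submodule.neg_mem _ (key' k i j h hij)
  · rw [gen_anticomm]
    exact Submodule.neg_mem _ (key k l i j hkl hij h)

theorem finrank_le_card_of_le_span {E ι : Type*} [AddCommGroup E] [Module ℚ E] [Fintype ι]
    {M : Submodule ℚ E} {g : ι → E} (h : M ≤ Submodule.span ℚ (Set.range g)) :
    Module.Finite ℚ M ∧ Module.finrank ℚ M ≤ Fintype.card ι := by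
  have : Module.Finite ℚ (Submodule.span ℚ (Set.range g)) :=
    Module.Finite.span_of_finite ℚ (Set.finite_range g)
  exact ⟨Submodule.finiteDimensional_of_le h,
    (Submodule.finrank_mono h).trans (finrank_range_le_card g)⟩

instance : Module.Finite ℚ (component n 1).toSubmodule :=
  (finrank_le_card_of_le_span component_one_le_span).1

instance : Module.Finite ℚ (component n 2).toSubmodule :=
  (finrank_le_card_of_le_span component_two_le_span).1

theorem two_mul_finrank_component_one_le (k : ℕ) :
    2 * Module.finrank ℚ (component (k + 1) 1).toSubmodule ≤ (k + 1) * k := by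
  have h := (finrank_le_card_of_le_span (component_one_le_span (n := k + 1))).2
  rw [Fintype.card_sigma] at h
  simp only [Fintype.card_fin] at h
  rw [Fin.sum_univ_eq_sum_range (fun i => i)] at h
  have h1 := Finset.sum_range_id_mul_two (k + 1)
  simp only [Nat.add_sub_cancel] at h1
  omega

/-- The spanning monomials number ∑ j·l over j < l < n, the second elementary symmetric function of
1, …, n − 1, which is n(n − 1)(n − 2)(3n − 1)/24; here n = k + 2. -/
theorem finrank_component_two_le (k : ℕ) :
    24 * Module.finrank ℚ (component (k + 2) 2).toSubmodule ≤
      (k + 2) * (k + 1) * k * (3 * k + 5) := by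
  have h := (finrank_le_card_of_le_span (component_two_le_span (n := k + 2))).2
  simp only [Fintype.card_sigma, Fintype.card_prod, Fintype.card_fin] at h
  rw [Fin.sum_univ_eq_sum_range (fun l => ∑ j : Fin l, (j : ℕ) * l)] at h
  have h1 : ∀ k, 24 * ∑ l ∈ Finset.range (k + 2), ∑ j : Fin l, (j : ℕ) * l =
      (k + 2) * (k + 1) * k * (3 * k + 5) := by
    intro k
    induction k with
    | zero => simp [Finset.sum_range_succ]
    | succ k ih =>
      rw [Finset.sum_range_succ, mul_add, ih, Fin.sum_univ_eq_sum_range (fun j => j * (k + 2)),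
        ← Finset.sum_mul]
      have h2 := Finset.sum_range_id_mul_two (k + 2)
      rw [show k + 2 - 1 = k + 1 by omega] at h2
      linear_combination 12 * (k + 2) * h2
  have := h1 k
  omega

/-! ### Functionals of degree one and two -/

/-- The action of the degree one elements on `ℚ × V × ℚ` given by a bilinear form on `V`. -/
def formAction {V : Type*} [AddCommGroup V] [Module ℚ V] (β : V →ₗ[ℚ] V →ₗ[ℚ] ℚ) :
    V →ₗ[ℚ] Module.End ℚ (ℚ × V × ℚ) :=
  LinearMap.mk₂ ℚ (fun v p => (0, p.1 • v, β v p.2.1))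
    (fun _ _ _ => by simp) (fun c v p => by simp [smul_comm p.1 c]) (fun _ _ _ => by simp [add_smul])
    (fun _ _ _ => by simp [mul_smul])

theorem formAction_apply {V : Type*} [AddCommGroup V] [Module ℚ V] (β : V →ₗ[ℚ] V →ₗ[ℚ] ℚ)
    (v : V) (p : ℚ × V × ℚ) : formAction β v p = (0, p.1 • v, β v p.2.1) := rfl

/-- The operator `(a, v, c) ↦ (0, 0, a)`. -/
def topShift (V : Type*) [AddCommGroup V] [Module ℚ V] : Module.End ℚ (ℚ × V × ℚ) :=
  LinearMap.inr ℚ ℚ (V × ℚ) ∘ₗ LinearMap.inr ℚ V ℚ ∘ₗ LinearMap.fst ℚ ℚ (V × ℚ)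

theorem topShift_apply {V : Type*} [AddCommGroup V] [Module ℚ V] (p : ℚ × V × ℚ) :
    topShift V p = (0, 0, p.1) := rfl

/-- Products of two degree one elements act through β alone. Thus an alternating β gives an action
of the exterior algebra, and the action descends to the Arnold algebra when β respects the braid
relations; this yields functionals on the quotient with no basis of it at hand. -/
theorem formAction_mul {V : Type*} [AddCommGroup V] [Module ℚ V]
    (β : V →ₗ[ℚ] V →ₗ[ℚ] ℚ) (u v : V) :
    formAction β u * formAction β v = β u v • topShift V := by
  refine LinearMap.ext fun p => ?_
  rw [Module.End.mul_apply, formAction_apply, formAction_apply, LinearMap.smul_apply,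
    topShift_apply]
  simp [mul_comm]

/-- The alternating form on the span of the generators given by its values. -/
def genForm (B : Gen n → Gen n → ℚ) : (Gen n →₀ ℚ) →ₗ[ℚ] (Gen n →₀ ℚ) →ₗ[ℚ] ℚ :=
  Finsupp.linearCombination ℚ fun e => Finsupp.linearCombination ℚ (B e)

theorem genForm_single (B : Gen n → Gen n → ℚ) (e f : Gen n) :
    genForm B (Finsupp.single e 1) (Finsupp.single f 1) = B e f := by
  simp [genForm]

theorem genForm_self {B : Gen n → Gen n → ℚ} (h : ∀ e f, B e f = -B f e) (v : Gen n →₀ ℚ) :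
    genForm B v v = 0 := by
  have h1 : genForm B = -(genForm B).flip := by
    ext e f
    simpa [genForm] using h e f
  have h2 := LinearMap.congr_fun (LinearMap.congr_fun h1 v) v
  simp only [LinearMap.neg_apply, LinearMap.flip_apply] at h2
  linarith

/-- Values of an alternating form on the generators that respects the braid relations. -/
structure IsBraidForm (B : Gen n → Gen n → ℚ) : Prop where
  antisymm : ∀ e f, B e f = -B f e
  braid : ∀ i j k (hij : i ≠ j) (hik : i ≠ k) (hjk : j ≠ k),
    B ⟨s(i, j), by simpa using hij⟩ ⟨s(i, k), by simpa using hik⟩ -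
      B ⟨s(i, j), by simpa using hij⟩ ⟨s(j, k), by simpa using hjk⟩ +
      B ⟨s(i, k), by simpa using hik⟩ ⟨s(j, k), by simpa using hjk⟩ = 0

/-- The action of the Arnold algebra on `ℚ × V × ℚ` given by a form. -/
def formHom {B : Gen n → Gen n → ℚ} (hB : IsBraidForm B) :
    Alg n →ₐ[ℚ] Module.End ℚ (ℚ × (Gen n →₀ ℚ) × ℚ) :=
  RingQuot.liftAlgHom ℚ ⟨ExteriorAlgebra.lift ℚ ⟨formAction (genForm B), fun v => by
      rw [formAction_mul, genForm_self hB.antisymm, zero_smul]⟩, by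
    rintro _ _ ⟨i, j, k, hij, hjk⟩
    simp only [yb, w, map_add, map_sub, map_mul, ExteriorAlgebra.lift_ι_apply, formAction_mul,
      genForm_single, map_zero]
    have h := congrArg (fun c => c • topShift (Gen n →₀ ℚ))
      (hB.braid i j k hij.ne (hij.trans hjk).ne hjk.ne)
    simp only [add_smul, sub_smul, zero_smul] at h
    exact h⟩

theorem formHom_edgeGen {B : Gen n → Gen n → ℚ} (hB : IsBraidForm B) (e : Gen n) :
    formHom hB (edgeGen e) = formAction (genForm B) (Finsupp.single e 1) := by
  simp only [formHom, edgeGen, proj, RingQuot.liftAlgHom_mkAlgHom_apply,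
    ExteriorAlgebra.lift_ι_apply]

/-- The functional of degree two with prescribed values on products of generators. -/
def quadFunctional {B : Gen n → Gen n → ℚ} (hB : IsBraidForm B) : Module.Dual ℚ (Alg n) :=
  (LinearMap.snd ℚ _ _ ∘ₗ LinearMap.snd ℚ _ _ ∘ₗ
    LinearMap.applyₗ ((1, 0, 0) : ℚ × (Gen n →₀ ℚ) × ℚ)) ∘ₗ (formHom hB).toLinearMap

theorem quadFunctional_edgeGen {B : Gen n → Gen n → ℚ} (hB : IsBraidForm B) (e f : Gen n) :
    quadFunctional hB (edgeGen e * edgeGen f) = B e f := by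
  simp only [quadFunctional, LinearMap.comp_apply, AlgHom.toLinearMap_apply, map_mul,
    formHom_edgeGen, LinearMap.applyₗ_apply_apply, formAction_mul, genForm_single,
    LinearMap.smul_apply, topShift_apply]
  simp

/-- Degree one functionals need only the middle coordinate of the action, for which the zero form is
enough. -/
theorem isBraidForm_zero : IsBraidForm (0 : Gen n → Gen n → ℚ) :=
  ⟨by simp, by simp⟩

/-- The linear functional of degree one with prescribed values on the generators. -/
def linFunctional (φ : Gen n → ℚ) : Module.Dual ℚ (Alg n) :=
  (Finsupp.linearCombination ℚ φ ∘ₗ LinearMap.fst ℚ _ _ ∘ₗ LinearMap.snd ℚ _ _ ∘ₗ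
    LinearMap.applyₗ ((1, 0, 0) : ℚ × (Gen n →₀ ℚ) × ℚ)) ∘ₗ
    (formHom isBraidForm_zero).toLinearMap

theorem linFunctional_edgeGen (φ : Gen n → ℚ) (e : Gen n) :
    linFunctional φ (edgeGen e) = φ e := by
  simp only [linFunctional, LinearMap.comp_apply, AlgHom.toLinearMap_apply, formHom_edgeGen,
    LinearMap.applyₗ_apply_apply, formAction_apply]
  simp

end Functionals

/-! ### Functionals attached to tabloids -/

section TabloidFunctionals

variable {n : ℕ} {l : List ℕ}

/-- Two edges have a common vertex. -/
def Meet (e f : Gen n) : Prop := ∃ x, x ∈ e.1 ∧ x ∈ f.1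

theorem Meet.symm {e f : Gen n} (h : Meet e f) : Meet f e :=
  let ⟨x, hx, hx'⟩ := h
  ⟨x, hx', hx⟩

theorem meet_comm (e f : Gen n) : Meet e f ↔ Meet f e := ⟨Meet.symm, Meet.symm⟩

theorem meet_permGen (π : Perm (Fin n)) (e f : Gen n) :
    Meet (permGen π e) (permGen π f) ↔ Meet e f := by
  constructor
  · rintro ⟨x, hx, hx'⟩
    obtain ⟨y, hy, rfl⟩ := Sym2.mem_map.1 hx
    obtain ⟨z, hz, hzy⟩ := Sym2.mem_map.1 hx'
    rw [π.injective hzy] at hz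
    exact ⟨y, hy, hz⟩
  · rintro ⟨x, hx, hx'⟩
    exact ⟨π x, Sym2.mem_map.2 ⟨x, hx, rfl⟩, Sym2.mem_map.2 ⟨x, hx', rfl⟩⟩

/-- The `2 × 2` determinant of the values of `φ` and `χ`. -/
def wedge (φ χ : Sym2 ℕ → ℚ) (e f : Sym2 ℕ) : ℚ := φ e * χ f - φ f * χ e

/-- The values of `φ` and `χ` on the sides of a triangle are affinely dependent. -/
def IsTriangular (φ χ : Sym2 ℕ → ℚ) : Prop :=
  ∀ x y z, wedge φ χ s(x, y) s(x, z) - wedge φ χ s(x, y) s(y, z) + wedge φ χ s(x, z) s(y, z) = 0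

open Classical in
/-- The form on the generators that depends on the rows of the vertices, restricted to the pairs
of edges that meet or to those that do not. -/
def rowForm (b : Prop) (φ χ : Sym2 ℕ → ℚ) (r : Fin n → ℕ) (e f : Gen n) : ℚ :=
  if Meet e f ↔ b then wedge φ χ (Sym2.map r e.1) (Sym2.map r f.1) else 0

/-- The sides of a triangle meet pairwise, so a form supported on disjoint pairs satisfies the braid
relations trivially, and triangularity matters only when `b` holds. -/
theorem isBraidForm_rowForm {b : Prop} {φ χ : Sym2 ℕ → ℚ} (h : b → IsTriangular φ χ)
    (r : Fin n → ℕ) : IsBraidForm (rowForm b φ χ r) where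
  antisymm e f := by
    by_cases hm : Meet f e ↔ b
    · rw [rowForm, rowForm, if_pos hm, if_pos ((meet_comm e f).trans hm)]
      simp only [wedge]
      ring
    · rw [rowForm, rowForm, if_neg hm, if_neg fun h' => hm ((meet_comm f e).trans h'), neg_zero]
  braid i j k hij hik hjk := by
    have h1 : Meet (⟨s(i, j), by simpa using hij⟩ : Gen n) ⟨s(i, k), by simpa using hik⟩ :=
      ⟨i, by simp, by simp⟩
    have h2 : Meet (⟨s(i, j), by simpa using hij⟩ : Gen n) ⟨s(j, k), by simpa using hjk⟩ :=
      ⟨j, by simp, by simp⟩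
    have h3 : Meet (⟨s(i, k), by simpa using hik⟩ : Gen n) ⟨s(j, k), by simpa using hjk⟩ :=
      ⟨k, by simp, by simp⟩
    by_cases hb : b
    · simpa [rowForm, h1, h2, h3, hb] using h hb (r i) (r j) (r k)
    · simp [rowForm, h1, h2, h3, hb]

/-- The functional of degree two given by `rowForm`. -/
abbrev rowFunctional {b : Prop} {φ χ : Sym2 ℕ → ℚ} (h : b → IsTriangular φ χ)
    (r : Fin n → ℕ) : Module.Dual ℚ (Alg n) :=
  quadFunctional (isBraidForm_rowForm h r)

section Evaluation

variable {b : Prop} {φ χ : Sym2 ℕ → ℚ} {h : b → IsTriangular φ χ} {r : Fin n → ℕ}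

theorem rowFunctional_meet (hb : b) {i j k : Fin n} (hij : i ≠ j) (hik : i ≠ k) :
    rowFunctional h r (gen i j * gen i k) = wedge φ χ s(r i, r j) s(r i, r k) := by
  rw [gen_eq_edgeGen hij, gen_eq_edgeGen hik, quadFunctional_edgeGen, rowForm, if_pos]
  · rfl
  · exact iff_of_true ⟨i, by simp, by simp⟩ hb

theorem rowFunctional_meet_eq_zero (hb : ¬ b) {i j k : Fin n} (hij : i ≠ j) (hik : i ≠ k) :
    rowFunctional h r (gen i j * gen i k) = 0 := by
  rw [gen_eq_edgeGen hij, gen_eq_edgeGen hik, quadFunctional_edgeGen, rowForm, if_neg]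
  exact fun hh => hb (hh.1 ⟨i, by simp, by simp⟩)

theorem not_meet {i j k m : Fin n} (hij : i ≠ j) (hkm : k ≠ m) (hik : i ≠ k) (him : i ≠ m)
    (hjk : j ≠ k) (hjm : j ≠ m) :
    ¬ Meet (⟨s(i, j), by simpa using hij⟩ : Gen n) ⟨s(k, m), by simpa using hkm⟩ := by
  rintro ⟨x, hx, hx'⟩
  rw [Sym2.mem_iff] at hx hx'
  rcases hx with rfl | rfl <;> rcases hx' with h | h <;> contradiction

theorem rowFunctional_disjoint (hb : ¬ b) {i j k m : Fin n} (hij : i ≠ j) (hkm : k ≠ m)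
    (hik : i ≠ k) (him : i ≠ m) (hjk : j ≠ k) (hjm : j ≠ m) :
    rowFunctional h r (gen i j * gen k m) = wedge φ χ s(r i, r j) s(r k, r m) := by
  rw [gen_eq_edgeGen hij, gen_eq_edgeGen hkm, quadFunctional_edgeGen, rowForm, if_pos]
  · rfl
  · exact iff_of_false (not_meet hij hkm hik him hjk hjm) hb

theorem rowFunctional_disjoint_eq_zero (hb : b) {i j k m : Fin n} (hij : i ≠ j) (hkm : k ≠ m)
    (hik : i ≠ k) (him : i ≠ m) (hjk : j ≠ k) (hjm : j ≠ m) :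
    rowFunctional h r (gen i j * gen k m) = 0 := by
  rw [gen_eq_edgeGen hij, gen_eq_edgeGen hkm, quadFunctional_edgeGen, rowForm, if_neg]
  exact fun hh => not_meet hij hkm hik him hjk hjm (hh.2 hb)

end Evaluation

theorem rowForm_smul (b : Prop) (φ χ : Sym2 ℕ → ℚ) (π : Perm (Fin n)) (T : Tabloid n l)
    (e f : Gen n) :
    rowForm b φ χ (fun x => (π • T).row x) (permGen π e) (permGen π f) =
      rowForm b φ χ (fun x => T.row x) e f := by
  have h : ∀ e : Gen n, Sym2.map (fun x => ((π • T).row x : ℕ)) (permGen π e).1 =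
      Sym2.map (fun x => (T.row x : ℕ)) e.1 := by
    intro e
    simp [permGen, Sym2.map_map, Tabloid.smul_row]
  by_cases hm : Meet e f ↔ b
  · rw [rowForm, rowForm, if_pos hm, if_pos ((meet_permGen π e f).trans hm), h, h]
  · rw [rowForm, rowForm, if_neg hm, if_neg fun h' => hm ((meet_permGen π e f).symm.trans h')]

theorem isTabloidFamily_rowFunctional {b : Prop} {φ χ : Sym2 ℕ → ℚ} (h : b → IsTriangular φ χ) :
    IsTabloidFamily (l := l) (componentRep n 2) fun T =>
      rowFunctional h (fun x => (T.row x : ℕ)) ∘ₗ (component n 2).toSubmodule.subtype := by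
  rintro π T ⟨x, hx⟩
  change rowFunctional h _ (act π x) = rowFunctional h _ x
  rw [component_two_eq_span] at hx
  induction hx using Submodule.span_induction with
  | mem _ hx =>
    obtain ⟨⟨e, f⟩, rfl⟩ := hx
    rw [map_mul, act_edgeGen, act_edgeGen, quadFunctional_edgeGen, quadFunctional_edgeGen,
      rowForm_smul]
  | zero => simp
  | add a b _ _ ha hb => simp only [map_add, ha, hb]
  | smul c a _ ha => simp only [map_smul, ha]

theorem isTabloidFamily_linFunctional (φ : Sym2 ℕ → ℚ) :
    IsTabloidFamily (l := l) (componentRep n 1) fun T =>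
      linFunctional (fun e => φ (Sym2.map (fun x => (T.row x : ℕ)) e.1)) ∘ₗ
        (component n 1).toSubmodule.subtype := by
  rintro π T ⟨x, hx⟩
  change linFunctional _ (act π x) = linFunctional _ x
  rw [component_one_eq_span] at hx
  induction hx using Submodule.span_induction with
  | mem _ hx =>
    obtain ⟨e, rfl⟩ := hx
    rw [act_edgeGen, linFunctional_edgeGen, linFunctional_edgeGen]
    simp [permGen, Sym2.map_map, Tabloid.smul_row]
  | zero => simp
  | add a b _ _ ha hb => simp only [map_add, ha, hb]
  | smul c a _ ha => simp only [map_smul, ha]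

/-! ### Column alternating elements -/

/-- The element `x` of the Arnold algebra changes sign under the transpositions within columns. -/
def Tableau.SwapAlternating (t : Tableau n l) (x : Alg n) : Prop :=
  ∀ p q, (t.row p : ℕ) < t.row q → t.col p = t.col q → act (Equiv.swap p q) x = -x

/-- Transpositions within columns generate the column stabilizer: multiplying σ by the swap of a and
σ a stays inside it and shrinks the support, so induction on the support applies. -/
theorem Tableau.SwapAlternating.act_eq {t : Tableau n l} {x : Alg n} (h : t.SwapAlternating x)
    {σ : Perm (Fin n)} (hσ : σ ∈ t.colStab) : act σ x = ((Perm.sign σ : ℤ) : ℚ) • x := by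
  have hswap : ∀ p q, p ≠ q → t.col p = t.col q → act (Equiv.swap p q) x = -x := by
    intro p q hpq hc
    rcases lt_trichotomy (t.row p) (t.row q) with hr | hr | hr
    · exact h p q hr hc
    · exact absurd (t.ext_row_col hr hc) hpq
    · rw [Equiv.swap_comm]
      exact h q p hr hc.symm
  have hmul : ∀ (π τ : Perm (Fin n)), act (π * τ) x = act π (act τ x) := fun π τ =>
    LinearMap.congr_fun ((algRep n).map_mul π τ) x
  induction hc : σ.support.card using Nat.strong_induction_on generalizing σ with
  | _ m ih =>
    by_cases h1 : σ = 1
    · subst h1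
      have : act (1 : Perm (Fin n)) x = x := LinearMap.congr_fun ((algRep n).map_one) x
      simp [this]
    · obtain ⟨a, ha⟩ : ∃ a, σ a ≠ a := by
        by_contra! hno
        exact h1 (Equiv.ext hno)
      have hca := Tableau.mem_colStab.1 hσ a
      have hlt := Perm.card_support_swap_mul ha
      have h2 := ih _ (hc ▸ hlt)
        (Tableau.mul_mem_colStab (Tableau.swap_mem_colStab hca.symm) hσ) rfl
      have h3 : σ = Equiv.swap a (σ a) * (Equiv.swap a (σ a) * σ) := by
        rw [← mul_assoc, Equiv.swap_mul_self, one_mul]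
      conv_lhs => rw [h3]
      rw [hmul, h2, map_smul, hswap a (σ a) ha.symm hca.symm, Perm.sign_mul,
        Perm.sign_swap ha.symm]
      simp

theorem Tableau.SwapAlternating.isColAlternating {t : Tableau n l} {x : Alg n} {k : ℕ}
    (h : t.SwapAlternating x) (hx : x ∈ (component n k).toSubmodule) :
    IsColAlternating (componentRep n k) t ⟨x, hx⟩ :=
  fun _ hσ => Subtype.ext (h.act_eq hσ)

/-- The shape `l` is detected on the products of meeting edges (if `b` holds) or of disjoint edges
(if `b` fails). -/
def PairDetects (n : ℕ) (l : List ℕ) (b : Prop) : Prop :=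
  ∃ (φ χ : Sym2 ℕ → ℚ) (h : b → IsTriangular φ χ) (t : Tableau n l) (x : Alg n),
    x ∈ (component n 2).toSubmodule ∧ t.SwapAlternating x ∧
      rowFunctional h (fun y => (t.row y : ℕ)) x ≠ 0 ∧
      ∀ (b' : Prop) (φ' χ' : Sym2 ℕ → ℚ) (h' : b' → IsTriangular φ' χ'), (b' ↔ ¬ b) →
        rowFunctional h' (fun y => (t.row y : ℕ)) x = 0

theorem PairDetects.detects {b : Prop} (h : PairDetects n l b) :
    Detects (componentRep n 2) l 1 := by
  obtain ⟨φ, χ, h, t, x, hx, ha, h1, h2⟩ := h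
  refine ⟨fun _ => _, fun _ => isTabloidFamily_rowFunctional h, fun k => ⟨t, ⟨x, hx⟩,
    ha.isColAlternating hx, h1, fun k' hk' => absurd (Subsingleton.elim k' k) hk'⟩⟩

/-- Each test vector is invisible to the form of the other kind, so the matrix of values is
diagonal. -/
theorem PairDetects.detects_two (h : PairDetects n l True) (h' : PairDetects n l False) :
    Detects (componentRep n 2) l 2 := by
  obtain ⟨φ, χ, h, t, x, hx, ha, h1, h2⟩ := h
  obtain ⟨φ', χ', h', t', x', hx', ha', h1', h2'⟩ := h'
  refine ⟨![fun T => rowFunctional h (fun x => (T.row x : ℕ)) ∘ₗ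
      (component n 2).toSubmodule.subtype,
    fun T => rowFunctional h' (fun x => (T.row x : ℕ)) ∘ₗ
      (component n 2).toSubmodule.subtype], ?_, ?_⟩
  · intro k
    fin_cases k
    · exact isTabloidFamily_rowFunctional h
    · exact isTabloidFamily_rowFunctional h'
  · intro k
    fin_cases k
    · refine ⟨t, ⟨x, hx⟩, ha.isColAlternating hx, h1, fun k' hk' => ?_⟩
      fin_cases k'
      · exact absurd rfl hk'
      · exact h2 _ _ _ h' (by simp)
    · refine ⟨t', ⟨x', hx'⟩, ha'.isColAlternating hx', h1', fun k' hk' => ?_⟩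
      fin_cases k'
      · exact h2' _ _ _ h (by simp)
      · exact absurd rfl hk'

end TabloidFunctionals

/-! ### Detection of the individual shapes -/

section Detection

variable {n : ℕ} {l : List ℕ}

theorem exists_tableau (h : l.sum = n) : Nonempty (Tableau n l) := by
  refine ⟨Fintype.equivFinOfCardEq ?_⟩
  rw [← h, Fintype.card_sigma, ← Fin.sum_univ_getElem]
  simp

/-- Indexing cells by natural numbers, with arbitrary values outside the diagram, permits case
analysis on numerical coordinates; `hn` supplies the arbitrary values. -/
theorem Tableau.exists_points (t : Tableau n l) (hn : 0 < n) :
    ∃ P : ℕ → ℕ → Fin n, ∀ i j, j < l.getD i 0 → (t.row (P i j) : ℕ) = i ∧ t.col (P i j) = j := by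
  have := Fin.pos_iff_nonempty.1 hn
  have h : ∀ i j, j < l.getD i 0 → ∃ x, (t.row x : ℕ) = i ∧ t.col x = j := by
    intro i j h
    have hi : i < l.length := by
      by_contra hi
      rw [List.getD_eq_default _ _ (by omega)] at h
      omega
    rw [List.getD_eq_getElem _ _ hi] at h
    exact ⟨t ⟨⟨i, hi⟩, ⟨j, h⟩⟩, by simp, by simp⟩
  choose! P hP using h
  exact ⟨P, hP⟩

theorem Tableau.col_lt_getD (t : Tableau n l) (x : Fin n) : t.col x < l.getD (t.row x) 0 := by
  rw [List.getD_eq_getElem _ _ (t.row x).2]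
  exact t.col_lt x

theorem Tableau.swapAlternating_of_points (t : Tableau n l) {x : Alg n} {P : ℕ → ℕ → Fin n}
    (hP : ∀ i j, j < l.getD i 0 → (t.row (P i j) : ℕ) = i ∧ t.col (P i j) = j)
    (h : ∀ i i' j, i < i' → i' < l.length → j < l.getD i' 0 →
      act (Equiv.swap (P i j) (P i' j)) x = -x) : t.SwapAlternating x := by
  have key : ∀ z, P (t.row z) (t.col z) = z := fun z =>
    t.ext_row_col (Fin.ext (hP _ _ (t.col_lt_getD z)).1) (hP _ _ (t.col_lt_getD z)).2
  intro p q hr hc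
  have := h (t.row p) (t.row q) (t.col q) hr (t.row q).2 (t.col_lt_getD q)
  rwa [key, ← hc, key] at this

/-- The indicator function of an unordered pair. -/
def pairIndicator (e : Sym2 ℕ) : Sym2 ℕ → ℚ := fun f => if f = e then 1 else 0

/-- The antisymmetrized product of two families of elements. -/
def bracket (U V : Fin n → Alg n) (p q : Fin n) : Alg n := U p * V q - U q * V p

theorem bracket_mem {U V : Fin n → Alg n} (hU : ∀ p, U p ∈ (component n 1).toSubmodule)
    (hV : ∀ p, V p ∈ (component n 1).toSubmodule) (p q : Fin n) :
    bracket U V p q ∈ (component n 2).toSubmodule :=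
  Submodule.sub_mem _ (mul_mem_component_two (hU p) (hV q)) (mul_mem_component_two (hU q) (hV p))

theorem gen_sub_gen_mem (a b p : Fin n) : gen a p - gen b p ∈ (component n 1).toSubmodule :=
  Submodule.sub_mem _ (gen_mem a p) (gen_mem b p)

/-- The antisymmetrized product, summed over the sides of an oriented triangle. -/
def bracket₃ (U V : Fin n → Alg n) (p q s : Fin n) : Alg n :=
  bracket U V p q + bracket U V q s + bracket U V s p

theorem bracket₃_mem {U V : Fin n → Alg n} (hU : ∀ p, U p ∈ (component n 1).toSubmodule)
    (hV : ∀ p, V p ∈ (component n 1).toSubmodule) (p q s : Fin n) :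
    bracket₃ U V p q s ∈ (component n 2).toSubmodule :=
  Submodule.add_mem _ (Submodule.add_mem _ (bracket_mem hU hV _ _) (bracket_mem hU hV _ _))
    (bracket_mem hU hV _ _)

/-! ### Test vectors on pairs of meeting edges -/

theorem isTriangular_zero_one_zero_zero :
    IsTriangular (pairIndicator s(0, 1)) (pairIndicator s(0, 0)) := by
  intro x y z
  rcases x with _ | _ | _ | x <;> rcases y with _ | _ | _ | y <;> rcases z with _ | _ | _ | z <;>
    simp [wedge, pairIndicator]

/-- With p, q in the first column and b = P 0 1, the vector is w_bp w_bq − w_bq w_bp = 2 w_bp w_bq,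
which changes sign under p ↔ q. -/
theorem pairDetects_meet_one {a : ℕ} (ha : 2 ≤ a) (hn : [a, 1].sum = n) :
    PairDetects n [a, 1] True := by
  obtain ⟨t⟩ := exists_tableau hn
  obtain ⟨P, hP⟩ := t.exists_points (by simp at hn; omega)
  have h0 : ∀ j < 2, _ := fun j hj => hP 0 j (hj.trans_le ha)
  have hd : [P 0 0, P 0 1, P 1 0].Nodup :=
    List.Nodup.of_map (fun x => ((t.row x : ℕ), t.col x)) (by simp [hP, h0])
  have hd' := List.nodup_reverse.2 hd
  simp at hd hd'
  refine ⟨pairIndicator s(0, 1), pairIndicator s(0, 0), fun _ => isTriangular_zero_one_zero_zero, t,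
    bracket (gen (P 0 1)) (gen (P 0 1)) (P 0 0) (P 1 0), ?_, ?_, ?_, ?_⟩
  · exact bracket_mem (gen_mem _) (gen_mem _) _ _
  · refine t.swapAlternating_of_points hP fun i i' j hi hi' hj => ?_
    simp only [List.length_cons, List.length_nil] at hi'
    interval_cases i' <;> interval_cases i <;>
      simp only [List.getD_cons_succ, List.getD_cons_zero] at hj <;> interval_cases j <;>
      simp [bracket, act_gen, Equiv.swap_apply_def, hd, hd']
  · simp [bracket, rowFunctional_meet trivial, hd, hd', hP, h0,
      wedge, pairIndicator]
    norm_num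
  · intro b' φ' χ' h' hb
    simp [bracket,
      rowFunctional_meet_eq_zero (show ¬ b' by simpa using hb), hd, hd']

theorem isTriangular_zero_one_one_one :
    IsTriangular (pairIndicator s(0, 1)) (pairIndicator s(1, 1)) := by
  intro x y z
  rcases x with _ | _ | _ | x <;> rcases y with _ | _ | _ | y <;> rcases z with _ | _ | _ | z <;>
    simp [wedge, pairIndicator]

theorem pairDetects_meet_two {a : ℕ} (ha : 2 ≤ a) (hn : [a, 2].sum = n) :
    PairDetects n [a, 2] True := by
  obtain ⟨t⟩ := exists_tableau hn
  obtain ⟨P, hP⟩ := t.exists_points (by simp at hn; omega)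
  have h0 : ∀ j < 2, _ := fun j hj => hP 0 j (hj.trans_le ha)
  have hd : [P 0 0, P 0 1, P 1 0, P 1 1].Nodup :=
    List.Nodup.of_map (fun x => ((t.row x : ℕ), t.col x)) (by simp [hP, h0])
  have hd' := List.nodup_reverse.2 hd
  simp at hd hd'
  refine ⟨pairIndicator s(0, 1), pairIndicator s(1, 1), fun _ => isTriangular_zero_one_one_one, t,
    -- Subtracting the same vector with centre P 1 1 makes it alternate under the second column as
    -- well.
    bracket (gen (P 0 1)) (gen (P 0 1)) (P 0 0) (P 1 0) -
      bracket (gen (P 1 1)) (gen (P 1 1)) (P 0 0) (P 1 0), ?_, ?_, ?_, ?_⟩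
  · exact Submodule.sub_mem _ (bracket_mem (gen_mem _) (gen_mem _) _ _)
      (bracket_mem (gen_mem _) (gen_mem _) _ _)
  · refine t.swapAlternating_of_points hP fun i i' j hi hi' hj => ?_
    simp only [List.length_cons, List.length_nil] at hi'
    interval_cases i' <;> interval_cases i <;>
      simp only [List.getD_cons_succ, List.getD_cons_zero] at hj <;> interval_cases j <;>
      simp [bracket, act_gen, Equiv.swap_apply_def, hd, hd'] <;> abel
  · simp [bracket, rowFunctional_meet trivial, hd, hd', hP, h0,
      wedge, pairIndicator]
  · intro b' φ' χ' h' hb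
    simp [bracket,
      rowFunctional_meet_eq_zero (show ¬ b' by simpa using hb), hd, hd']

/-- The values on the sides of any triangle must be collinear points of the plane; here two of the
three always coincide. The sum is needed for rows 0, 1, 2: the indicator of {0, 2} alone would give
(1, 0), (0, 1), (0, 0). -/
theorem isTriangular_zero_one_sum :
    IsTriangular (pairIndicator s(0, 1)) (pairIndicator s(0, 2) + pairIndicator s(1, 2)) := by
  intro x y z
  rcases x with _ | _ | _ | x <;> rcases y with _ | _ | _ | y <;> rcases z with _ | _ | _ | z <;>
    simp [wedge, pairIndicator]

theorem pairDetects_meet_one_one {a : ℕ} (ha : 2 ≤ a) (hn : [a, 1, 1].sum = n) :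
    PairDetects n [a, 1, 1] True := by
  obtain ⟨t⟩ := exists_tableau hn
  obtain ⟨P, hP⟩ := t.exists_points (by simp at hn; omega)
  have h0 : ∀ j < 2, _ := fun j hj => hP 0 j (hj.trans_le ha)
  have hd : [P 0 0, P 0 1, P 1 0, P 2 0].Nodup :=
    List.Nodup.of_map (fun x => ((t.row x : ℕ), t.col x)) (by simp [hP, h0])
  have hd' := List.nodup_reverse.2 hd
  simp at hd hd'
  refine ⟨pairIndicator s(0, 1), pairIndicator s(0, 2) + pairIndicator s(1, 2),
    fun _ => isTriangular_zero_one_sum, t,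
    -- The cyclic sum alternates under all permutations of the three entries of the first column.
    bracket₃ (gen (P 0 1)) (gen (P 0 1)) (P 0 0) (P 1 0) (P 2 0), ?_, ?_, ?_, ?_⟩
  · exact bracket₃_mem (gen_mem _) (gen_mem _) _ _ _
  · refine t.swapAlternating_of_points hP fun i i' j hi hi' hj => ?_
    simp only [List.length_cons, List.length_nil] at hi'
    interval_cases i' <;> interval_cases i <;>
      simp only [List.getD_cons_succ, List.getD_cons_zero] at hj <;> interval_cases j <;>
      simp [bracket₃, bracket, act_gen, Equiv.swap_apply_def, hd, hd'] <;> abel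
  · simp [bracket₃, bracket, rowFunctional_meet trivial, hd, hd', hP, h0,
      wedge, pairIndicator]
  · intro b' φ' χ' h' hb
    simp [bracket₃, bracket,
      rowFunctional_meet_eq_zero (show ¬ b' by simpa using hb), hd, hd']

theorem isTriangular_one_one_one_two :
    IsTriangular (pairIndicator s(1, 1)) (pairIndicator s(1, 2)) := by
  intro x y z
  rcases x with _ | _ | _ | x <;> rcases y with _ | _ | _ | y <;> rcases z with _ | _ | _ | z <;>
    simp [wedge, pairIndicator]

theorem pairDetects_meet_two_one {a : ℕ} (ha : 2 ≤ a) (hn : [a, 2, 1].sum = n) :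
    PairDetects n [a, 2, 1] True := by
  obtain ⟨t⟩ := exists_tableau hn
  obtain ⟨P, hP⟩ := t.exists_points (by simp at hn; omega)
  have h0 : ∀ j < 2, _ := fun j hj => hP 0 j (hj.trans_le ha)
  have hd : [P 0 0, P 0 1, P 1 0, P 1 1, P 2 0].Nodup :=
    List.Nodup.of_map (fun x => ((t.row x : ℕ), t.col x)) (by simp [hP, h0])
  have hd' := List.nodup_reverse.2 hd
  simp at hd hd'
  refine ⟨pairIndicator s(1, 1), pairIndicator s(1, 2), fun _ => isTriangular_one_one_one_two, t,
    bracket₃ (gen (P 0 1)) (gen (P 0 1)) (P 0 0) (P 1 0) (P 2 0) -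
      bracket₃ (gen (P 1 1)) (gen (P 1 1)) (P 0 0) (P 1 0) (P 2 0), ?_, ?_, ?_, ?_⟩
  · exact Submodule.sub_mem _ (bracket₃_mem (gen_mem _) (gen_mem _) _ _ _)
      (bracket₃_mem (gen_mem _) (gen_mem _) _ _ _)
  · refine t.swapAlternating_of_points hP fun i i' j hi hi' hj => ?_
    simp only [List.length_cons, List.length_nil] at hi'
    interval_cases i' <;> interval_cases i <;>
      simp only [List.getD_cons_succ, List.getD_cons_zero] at hj <;> interval_cases j <;>
      simp [bracket₃, bracket, act_gen, Equiv.swap_apply_def, hd, hd'] <;> abel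
  · simp [bracket₃, bracket, rowFunctional_meet trivial, hd, hd', hP, h0,
      wedge, pairIndicator]
  · intro b' φ' χ' h' hb
    simp [bracket₃, bracket,
      rowFunctional_meet_eq_zero (show ¬ b' by simpa using hb), hd, hd']

/-! ### Test vectors on pairs of disjoint edges -/

theorem pairDetects_disjoint_one {a : ℕ} (ha : 3 ≤ a) (hn : [a, 1].sum = n) :
    PairDetects n [a, 1] False := by
  obtain ⟨t⟩ := exists_tableau hn
  obtain ⟨P, hP⟩ := t.exists_points (by simp at hn; omega)
  have h0 : ∀ j < 3, _ := fun j hj => hP 0 j (hj.trans_le ha)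
  have hd : [P 0 0, P 0 1, P 0 2, P 1 0].Nodup :=
    List.Nodup.of_map (fun x => ((t.row x : ℕ), t.col x)) (by simp [hP, h0])
  have hd' := List.nodup_reverse.2 hd
  simp at hd hd'
  refine ⟨pairIndicator s(0, 1), pairIndicator s(0, 0), False.elim, t,
    bracket (gen (P 0 1))
      (gen (P 0 2)) (P 0 0) (P 1 0), ?_, ?_, ?_, ?_⟩
  · exact bracket_mem (gen_mem _) (gen_mem _) _ _
  · refine t.swapAlternating_of_points hP fun i i' j hi hi' hj => ?_
    simp only [List.length_cons, List.length_nil] at hi'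
    interval_cases i' <;> interval_cases i <;>
      simp only [List.getD_cons_succ, List.getD_cons_zero] at hj <;> interval_cases j <;>
      simp [bracket, act_gen, Equiv.swap_apply_def, hd, hd']
  · simp [bracket, rowFunctional_disjoint not_false, hd, hd', hP, h0,
      wedge, pairIndicator]
    norm_num
  · intro b' φ' χ' h' hb
    simp [bracket,
      rowFunctional_disjoint_eq_zero (show b' by simpa using hb), hd, hd']

theorem pairDetects_disjoint_two {a : ℕ} (ha : 3 ≤ a) (hn : [a, 2].sum = n) :
    PairDetects n [a, 2] False := by
  obtain ⟨t⟩ := exists_tableau hn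
  obtain ⟨P, hP⟩ := t.exists_points (by simp at hn; omega)
  have h0 : ∀ j < 3, _ := fun j hj => hP 0 j (hj.trans_le ha)
  have hd : [P 0 0, P 0 1, P 0 2, P 1 0, P 1 1].Nodup :=
    List.Nodup.of_map (fun x => ((t.row x : ℕ), t.col x)) (by simp [hP, h0])
  have hd' := List.nodup_reverse.2 hd
  simp at hd hd'
  refine ⟨pairIndicator s(1, 1), pairIndicator s(0, 0), False.elim, t,
    bracket (fun p => gen (P 0 1) p - gen (P 1 1) p)
      (gen (P 0 2)) (P 0 0) (P 1 0), ?_, ?_, ?_, ?_⟩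
  · exact bracket_mem (gen_sub_gen_mem _ _) (gen_mem _) _ _
  · refine t.swapAlternating_of_points hP fun i i' j hi hi' hj => ?_
    simp only [List.length_cons, List.length_nil] at hi'
    interval_cases i' <;> interval_cases i <;>
      simp only [List.getD_cons_succ, List.getD_cons_zero] at hj <;> interval_cases j <;>
      simp [bracket, sub_mul, act_gen, Equiv.swap_apply_def, hd, hd'] <;> abel
  · simp [bracket, sub_mul, rowFunctional_disjoint not_false, hd, hd', hP, h0,
      wedge, pairIndicator]
  · intro b' φ' χ' h' hb
    simp [bracket, sub_mul,
      rowFunctional_disjoint_eq_zero (show b' by simpa using hb), hd, hd']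

/-- The two edges leave the first column towards the second and the third column respectively. A
column of height two there is alternated by replacing `gen b` with a difference of generators; doing
so in both columns gives a second row of length 3. -/
theorem pairDetects_disjoint_three {a : ℕ} (ha : 3 ≤ a) (hn : [a, 3].sum = n) :
    PairDetects n [a, 3] False := by
  obtain ⟨t⟩ := exists_tableau hn
  obtain ⟨P, hP⟩ := t.exists_points (by simp at hn; omega)
  have h0 : ∀ j < 3, _ := fun j hj => hP 0 j (hj.trans_le ha)
  have hd : [P 0 0, P 0 1, P 0 2, P 1 0, P 1 1, P 1 2].Nodup :=
    List.Nodup.of_map (fun x => ((t.row x : ℕ), t.col x)) (by simp [hP, h0])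
  have hd' := List.nodup_reverse.2 hd
  simp at hd hd'
  refine ⟨pairIndicator s(1, 1), pairIndicator s(0, 1), False.elim, t,
    bracket (fun p => gen (P 0 1) p - gen (P 1 1) p)
      (fun p => gen (P 0 2) p - gen (P 1 2) p) (P 0 0) (P 1 0), ?_, ?_, ?_, ?_⟩
  · exact bracket_mem (gen_sub_gen_mem _ _) (gen_sub_gen_mem _ _) _ _
  · refine t.swapAlternating_of_points hP fun i i' j hi hi' hj => ?_
    simp only [List.length_cons, List.length_nil] at hi'
    interval_cases i' <;> interval_cases i <;>
      simp only [List.getD_cons_succ, List.getD_cons_zero] at hj <;> interval_cases j <;>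
      simp [bracket, mul_sub, sub_mul, act_gen, Equiv.swap_apply_def, hd, hd'] <;> abel
  · simp [bracket, mul_sub, sub_mul, rowFunctional_disjoint not_false, hd, hd', hP, h0,
      wedge, pairIndicator]
    norm_num
  · intro b' φ' χ' h' hb
    simp [bracket, mul_sub, sub_mul,
      rowFunctional_disjoint_eq_zero (show b' by simpa using hb), hd, hd']

theorem pairDetects_disjoint_one_one {a : ℕ} (ha : 3 ≤ a) (hn : [a, 1, 1].sum = n) :
    PairDetects n [a, 1, 1] False := by
  obtain ⟨t⟩ := exists_tableau hn
  obtain ⟨P, hP⟩ := t.exists_points (by simp at hn; omega)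
  have h0 : ∀ j < 3, _ := fun j hj => hP 0 j (hj.trans_le ha)
  have hd : [P 0 0, P 0 1, P 0 2, P 1 0, P 2 0].Nodup :=
    List.Nodup.of_map (fun x => ((t.row x : ℕ), t.col x)) (by simp [hP, h0])
  have hd' := List.nodup_reverse.2 hd
  simp at hd hd'
  refine ⟨pairIndicator s(0, 1), pairIndicator s(0, 2), False.elim, t,
    bracket₃ (gen (P 0 1))
      (gen (P 0 2)) (P 0 0) (P 1 0) (P 2 0), ?_, ?_, ?_, ?_⟩
  · exact bracket₃_mem (gen_mem _) (gen_mem _) _ _ _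
  · refine t.swapAlternating_of_points hP fun i i' j hi hi' hj => ?_
    simp only [List.length_cons, List.length_nil] at hi'
    interval_cases i' <;> interval_cases i <;>
      simp only [List.getD_cons_succ, List.getD_cons_zero] at hj <;> interval_cases j <;>
      simp [bracket₃, bracket, act_gen, Equiv.swap_apply_def, hd, hd'] <;> abel
  · simp [bracket₃, bracket, rowFunctional_disjoint not_false, hd, hd', hP, h0,
      wedge, pairIndicator]
  · intro b' φ' χ' h' hb
    simp [bracket₃, bracket,
      rowFunctional_disjoint_eq_zero (show b' by simpa using hb), hd, hd']

theorem pairDetects_disjoint_two_one {a : ℕ} (ha : 3 ≤ a) (hn : [a, 2, 1].sum = n) :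
    PairDetects n [a, 2, 1] False := by
  obtain ⟨t⟩ := exists_tableau hn
  obtain ⟨P, hP⟩ := t.exists_points (by simp at hn; omega)
  have h0 : ∀ j < 3, _ := fun j hj => hP 0 j (hj.trans_le ha)
  have hd : [P 0 0, P 0 1, P 0 2, P 1 0, P 1 1, P 2 0].Nodup :=
    List.Nodup.of_map (fun x => ((t.row x : ℕ), t.col x)) (by simp [hP, h0])
  have hd' := List.nodup_reverse.2 hd
  simp at hd hd'
  refine ⟨pairIndicator s(1, 1), pairIndicator s(0, 2), False.elim, t,
    bracket₃ (fun p => gen (P 0 1) p - gen (P 1 1) p)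
      (gen (P 0 2)) (P 0 0) (P 1 0) (P 2 0), ?_, ?_, ?_, ?_⟩
  · exact bracket₃_mem (gen_sub_gen_mem _ _) (gen_mem _) _ _ _
  · refine t.swapAlternating_of_points hP fun i i' j hi hi' hj => ?_
    simp only [List.length_cons, List.length_nil] at hi'
    interval_cases i' <;> interval_cases i <;>
      simp only [List.getD_cons_succ, List.getD_cons_zero] at hj <;> interval_cases j <;>
      simp [bracket₃, bracket, sub_mul, act_gen, Equiv.swap_apply_def, hd, hd'] <;> abel
  · simp [bracket₃, bracket, sub_mul, rowFunctional_disjoint not_false, hd, hd', hP, h0,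
      wedge, pairIndicator]
  · intro b' φ' χ' h' hb
    simp [bracket₃, bracket, sub_mul,
      rowFunctional_disjoint_eq_zero (show b' by simpa using hb), hd, hd']

theorem pairDetects_disjoint_three_one {a : ℕ} (ha : 3 ≤ a) (hn : [a, 3, 1].sum = n) :
    PairDetects n [a, 3, 1] False := by
  obtain ⟨t⟩ := exists_tableau hn
  obtain ⟨P, hP⟩ := t.exists_points (by simp at hn; omega)
  have h0 : ∀ j < 3, _ := fun j hj => hP 0 j (hj.trans_le ha)
  have hd : [P 0 0, P 0 1, P 0 2, P 1 0, P 1 1, P 1 2, P 2 0].Nodup :=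
    List.Nodup.of_map (fun x => ((t.row x : ℕ), t.col x)) (by simp [hP, h0])
  have hd' := List.nodup_reverse.2 hd
  simp at hd hd'
  refine ⟨pairIndicator s(1, 2), pairIndicator s(1, 1), False.elim, t,
    bracket₃ (fun p => gen (P 0 1) p - gen (P 1 1) p)
      (fun p => gen (P 0 2) p - gen (P 1 2) p) (P 0 0) (P 1 0) (P 2 0), ?_, ?_, ?_, ?_⟩
  · exact bracket₃_mem (gen_sub_gen_mem _ _) (gen_sub_gen_mem _ _) _ _ _
  · refine t.swapAlternating_of_points hP fun i i' j hi hi' hj => ?_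
    simp only [List.length_cons, List.length_nil] at hi'
    interval_cases i' <;> interval_cases i <;>
      simp only [List.getD_cons_succ, List.getD_cons_zero] at hj <;> interval_cases j <;>
      simp [bracket₃, bracket, mul_sub, sub_mul, act_gen, Equiv.swap_apply_def, hd, hd'] <;> abel
  · simp [bracket₃, bracket, mul_sub, sub_mul, rowFunctional_disjoint not_false, hd, hd', hP, h0,
      wedge, pairIndicator]
    norm_num
  · intro b' φ' χ' h' hb
    simp [bracket₃, bracket, mul_sub, sub_mul,
      rowFunctional_disjoint_eq_zero (show b' by simpa using hb), hd, hd']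

end Detection

/-! ### Detection in degree one -/

section DegreeOne

variable {n : ℕ} {l : List ℕ}

theorem detects_of_linFunctional (φ : Sym2 ℕ → ℚ) (t : Tableau n l) {x : Alg n}
    (hx : x ∈ (component n 1).toSubmodule) (h : t.SwapAlternating x)
    (h0 : linFunctional (fun e => φ (Sym2.map (fun y => (t.row y : ℕ)) e.1)) x ≠ 0) :
    Detects (componentRep n 1) l 1 :=
  ⟨fun _ => _, fun _ => isTabloidFamily_linFunctional φ, fun k => ⟨t, ⟨x, hx⟩,
    h.isColAlternating hx, h0, fun k' hk' => absurd (Subsingleton.elim k' k) hk'⟩⟩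

theorem linFunctional_gen (φ : Sym2 ℕ → ℚ) (r : Fin n → ℕ) {i j : Fin n} (h : i ≠ j) :
    linFunctional (fun e => φ (Sym2.map r e.1)) (gen i j) = φ s(r i, r j) := by
  rw [gen_eq_edgeGen h, linFunctional_edgeGen]
  rfl

theorem detects_component_one_trivial {a : ℕ} (ha : 2 ≤ a) (hn : [a].sum = n) :
    Detects (componentRep n 1) [a] 1 := by
  obtain ⟨t⟩ := exists_tableau hn
  obtain ⟨P, hP⟩ := t.exists_points (by simp at hn; omega)
  have h0 : ∀ j < 2, _ := fun j hj => hP 0 j (hj.trans_le ha)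
  have hd : [P 0 0, P 0 1].Nodup :=
    List.Nodup.of_map (fun x => ((t.row x : ℕ), t.col x)) (by simp [h0])
  simp only [List.nodup_cons, List.mem_singleton] at hd
  refine detects_of_linFunctional (pairIndicator s(0, 0)) t (gen_mem (P 0 0) (P 0 1)) ?_ ?_
  · refine t.swapAlternating_of_points hP fun i i' j hi hi' hj => ?_
    simp only [List.length_cons, List.length_nil] at hi'
    omega
  · rw [linFunctional_gen _ _ hd.1]
    simp [pairIndicator]

theorem detects_component_one_one {a : ℕ} (ha : 2 ≤ a) (hn : [a, 1].sum = n) :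
    Detects (componentRep n 1) [a, 1] 1 := by
  obtain ⟨t⟩ := exists_tableau hn
  obtain ⟨P, hP⟩ := t.exists_points (by simp at hn; omega)
  have h0 : ∀ j < 2, _ := fun j hj => hP 0 j (hj.trans_le ha)
  have hd : [P 0 0, P 0 1, P 1 0].Nodup :=
    List.Nodup.of_map (fun x => ((t.row x : ℕ), t.col x)) (by simp [hP, h0])
  have hd' := List.nodup_reverse.2 hd
  simp at hd hd'
  refine detects_of_linFunctional (pairIndicator s(0, 1)) t
    (x := gen (P 0 1) (P 0 0) - gen (P 0 1) (P 1 0))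
    (Submodule.sub_mem _ (gen_mem _ _) (gen_mem _ _)) ?_ ?_
  · refine t.swapAlternating_of_points hP fun i i' j hi hi' hj => ?_
    simp only [List.length_cons, List.length_nil] at hi'
    interval_cases i' <;> interval_cases i <;>
      simp only [List.getD_cons_succ, List.getD_cons_zero] at hj <;> interval_cases j <;>
      simp [act_gen, Equiv.swap_apply_def, hd, hd']
  · rw [map_sub, linFunctional_gen _ _ hd'.2, linFunctional_gen _ _ hd.2]
    simp [pairIndicator, hP, h0]

theorem detects_component_one_two {a : ℕ} (ha : 2 ≤ a) (hn : [a, 2].sum = n) :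
    Detects (componentRep n 1) [a, 2] 1 := by
  obtain ⟨t⟩ := exists_tableau hn
  obtain ⟨P, hP⟩ := t.exists_points (by simp at hn; omega)
  have h0 : ∀ j < 2, _ := fun j hj => hP 0 j (hj.trans_le ha)
  have hd : [P 0 0, P 0 1, P 1 0, P 1 1].Nodup :=
    List.Nodup.of_map (fun x => ((t.row x : ℕ), t.col x)) (by simp [hP, h0])
  have hd' := List.nodup_reverse.2 hd
  simp at hd hd'
  refine detects_of_linFunctional (pairIndicator s(1, 1)) t
    (x := gen (P 0 1) (P 0 0) - gen (P 1 1) (P 0 0) -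
      (gen (P 0 1) (P 1 0) - gen (P 1 1) (P 1 0)))
    (Submodule.sub_mem _ (gen_sub_gen_mem _ _ _) (gen_sub_gen_mem _ _ _)) ?_ ?_
  · refine t.swapAlternating_of_points hP fun i i' j hi hi' hj => ?_
    simp only [List.length_cons, List.length_nil] at hi'
    interval_cases i' <;> interval_cases i <;>
      simp only [List.getD_cons_succ, List.getD_cons_zero] at hj <;> interval_cases j <;>
      simp [act_gen, Equiv.swap_apply_def, hd, hd'] <;> abel
  · rw [map_sub, map_sub, map_sub, linFunctional_gen _ _ hd'.2.2, linFunctional_gen _ _ hd'.1.2.2,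
      linFunctional_gen _ _ hd.2.1.1, linFunctional_gen _ _ hd'.1.1]
    simp [pairIndicator, hP, h0]

end DegreeOne

/-! ### Dimension bounds for the Specht modules -/

section Dimensions

/-- Shapes with fewer than three rows are compared with the three-letter counts by adding empty
rows. -/
theorem getD_append_zero (l : List ℕ) (i : ℕ) : (l ++ [0]).getD i 0 = l.getD i 0 := by
  rcases lt_trichotomy i l.length with h | h | h
  · rw [List.getD_append _ _ _ _ h]
  · subst h; simp
  · rw [List.getD_eq_default _ _ (by simp; omega), List.getD_eq_default _ _ h.le]

theorem one_le_finrank_specht (k : ℕ) :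
    1 ≤ Module.finrank ℚ (spechtSub k [k]).toSubmodule :=
  (hasBallotWords₃_one_row k).le_finrank rfl fun i => by
    rw [show [k, 0, 0] = ([k] ++ [0]) ++ [0] from rfl, getD_append_zero, getD_append_zero]

theorem le_finrank_specht_one (k : ℕ) :
    k ≤ Module.finrank ℚ (spechtSub (k + 1) [k, 1]).toSubmodule :=
  (hasBallotWords₃_one k).le_finrank rfl fun i => (getD_append_zero [k, 1] i).symm

theorem le_finrank_specht_two (k : ℕ) :
    (k + 3) * k ≤ 2 * Module.finrank ℚ (spechtSub (k + 3) [k + 1, 2]).toSubmodule := by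
  obtain ⟨N, hN, h⟩ := exists_hasBallotWords₃_two k
  have := hN.le_finrank (n := k + 3) (l := [k + 1, 2]) (by omega)
    fun i => (getD_append_zero [k + 1, 2] i).symm
  omega

theorem le_finrank_specht_three (k : ℕ) :
    (k + 5) * (k + 4) * k ≤
      6 * Module.finrank ℚ (spechtSub (k + 5) [k + 2, 3]).toSubmodule := by
  obtain ⟨N, hN, h⟩ := exists_hasBallotWords₃_three k
  have := hN.le_finrank (n := k + 5) (l := [k + 2, 3]) (by omega)
    fun i => (getD_append_zero [k + 2, 3] i).symm
  omega

theorem le_finrank_specht_one_one (k : ℕ) :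
    k * (k + 1) ≤ 2 * Module.finrank ℚ (spechtSub (k + 2) [k, 1, 1]).toSubmodule := by
  obtain ⟨N, hN, h⟩ := exists_hasBallotWords₃_one_one k
  have := hN.le_finrank (n := k + 2) (l := [k, 1, 1]) (by omega) fun _ => rfl
  omega

theorem le_finrank_specht_two_one (k : ℕ) :
    (k + 4) * (k + 2) * k ≤
      3 * Module.finrank ℚ (spechtSub (k + 4) [k + 1, 2, 1]).toSubmodule := by
  obtain ⟨N, hN, h⟩ := exists_hasBallotWords₃_two_one k
  have := hN.le_finrank (n := k + 4) (l := [k + 1, 2, 1]) (by omega) fun _ => rfl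
  omega

theorem le_finrank_specht_three_one (k : ℕ) :
    (k + 6) * (k + 5) * (k + 3) * k ≤
      8 * Module.finrank ℚ (spechtSub (k + 6) [k + 2, 3, 1]).toSubmodule := by
  obtain ⟨N, hN, h⟩ := exists_hasBallotWords₃_three_one k
  have := hN.le_finrank (n := k + 6) (l := [k + 2, 3, 1]) (by omega) fun _ => rfl
  omega

end Dimensions

/-! ### The decompositions -/

section Decompositions

variable {n : ℕ}

theorem detects_component_two_one {a : ℕ} (ha : 3 ≤ a) (hn : [a, 1].sum = n) :
    Detects (componentRep n 2) [a, 1] 2 :=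
  (pairDetects_meet_one (by omega) hn).detects_two (pairDetects_disjoint_one ha hn)

theorem detects_component_two_two {a : ℕ} (ha : 3 ≤ a) (hn : [a, 2].sum = n) :
    Detects (componentRep n 2) [a, 2] 2 :=
  (pairDetects_meet_two (by omega) hn).detects_two (pairDetects_disjoint_two ha hn)

theorem detects_component_two_one_one {a : ℕ} (ha : 3 ≤ a) (hn : [a, 1, 1].sum = n) :
    Detects (componentRep n 2) [a, 1, 1] 2 :=
  (pairDetects_meet_one_one (by omega) hn).detects_two (pairDetects_disjoint_one_one ha hn)

theorem detects_component_two_two_one {a : ℕ} (ha : 3 ≤ a) (hn : [a, 2, 1].sum = n) :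
    Detects (componentRep n 2) [a, 2, 1] 2 :=
  (pairDetects_meet_two_one (by omega) hn).detects_two (pairDetects_disjoint_two_one ha hn)

theorem decomposesAs_component_one (k : ℕ) : DecomposesAs (componentRep (k + 4) 1)
    [(1, [k + 4]), (1, [k + 3, 1]), (1, [k + 2, 2])] := by
  refine decomposesAs_of_detects (by simp) ?_ ?_ ?_
  · simp only [List.pairwise_cons, List.mem_cons, List.not_mem_nil, or_false, forall_eq_or_imp,
      forall_eq, IsEmpty.forall_iff, implies_true, List.Pairwise.nil, and_true]
    refine ⟨⟨⟨1, ?_⟩, ⟨1, ?_⟩⟩, ⟨1, ?_⟩⟩ <;> simp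
  · simp only [List.mem_cons, List.not_mem_nil, or_false, forall_eq_or_imp, forall_eq]
    exact ⟨detects_component_one_trivial (by omega) (by simp),
      detects_component_one_one (by omega) (by simp),
      detects_component_one_two (by omega) (by simp)⟩
  -- With n = k + 4 the bounds match exactly: 1 + (n − 1) + n(n − 3)/2 = n(n − 1)/2.
  · have h0 := two_mul_finrank_component_one_le (k + 3)
    have h1 := one_le_finrank_specht (k + 4)
    have h2 := le_finrank_specht_one (k + 3)
    have h3 := le_finrank_specht_two (k + 1)
    simp only [List.map_cons, List.map_nil, List.sum_cons, List.sum_nil, one_mul]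
    simp only [add_assoc, Nat.reduceAdd] at h0 h1 h2 h3 ⊢
    linarith

theorem decomposesAs_component_two (k : ℕ) : DecomposesAs (componentRep (k + 7) 2)
    [(2, [k + 6, 1]), (2, [k + 5, 2]), (2, [k + 5, 1, 1]), (1, [k + 4, 3]),
      (2, [k + 4, 2, 1]), (1, [k + 3, 3, 1])] := by
  refine decomposesAs_of_detects (by simp) ?_ ?_ ?_
  · simp only [List.pairwise_cons, List.mem_cons, List.not_mem_nil, or_false, forall_eq_or_imp,
      forall_eq, IsEmpty.forall_iff, implies_true, List.Pairwise.nil, and_true]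
    -- First rows decide the order, except for two pairs with equal first rows, which need the first
    -- two rows.
    refine ⟨⟨⟨1, ?_⟩, ⟨1, ?_⟩, ⟨1, ?_⟩, ⟨1, ?_⟩, ⟨1, ?_⟩⟩,
      ⟨⟨2, ?_⟩, ⟨1, ?_⟩, ⟨1, ?_⟩, ⟨1, ?_⟩⟩, ⟨⟨1, ?_⟩, ⟨1, ?_⟩, ⟨1, ?_⟩⟩,
      ⟨⟨2, ?_⟩, ⟨1, ?_⟩⟩, ⟨1, ?_⟩⟩ <;> simp
  · simp only [List.mem_cons, List.not_mem_nil, or_false, forall_eq_or_imp, forall_eq]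
    exact ⟨detects_component_two_one (by omega) (by simp),
      detects_component_two_two (by omega) (by simp),
      detects_component_two_one_one (by omega) (by simp),
      (pairDetects_disjoint_three (by omega) (by simp)).detects,
      detects_component_two_two_one (by omega) (by simp),
      (pairDetects_disjoint_three_one (by omega) (by simp)).detects⟩
  -- The arguments are shifted so that every bound refers to n = k + 7; the weighted sum of the
  -- Specht bounds is then the same quartic in k as the upper bound.
  · have h0 := finrank_component_two_le (k + 5)
    have h1 := le_finrank_specht_one (k + 6)
    have h2 := le_finrank_specht_two (k + 4)
    have h3 := le_finrank_specht_one_one (k + 5)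
    have h4 := le_finrank_specht_three (k + 2)
    have h5 := le_finrank_specht_two_one (k + 3)
    have h6 := le_finrank_specht_three_one (k + 1)
    simp only [List.map_cons, List.map_nil, List.sum_cons, List.sum_nil, one_mul]
    simp only [add_assoc, Nat.reduceAdd] at h0 h1 h2 h3 h4 h5 h6 ⊢
    linarith

theorem decomposesAs_component_two_of_two : DecomposesAs (componentRep 2 2) [] := by
  refine decomposesAs_of_detects (by simp) (by simp) (by simp) ?_
  have h0 := finrank_component_two_le 0
  simpa using h0

theorem decomposesAs_component_two_of_three :
    DecomposesAs (componentRep 3 2) [(1, [2, 1])] := by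
  refine decomposesAs_of_detects (by simp) (by simp) ?_ ?_
  · simp only [List.mem_singleton, forall_eq]
    exact (pairDetects_meet_one (by omega) (by simp)).detects
  · have h0 : 24 * Module.finrank ℚ (component 3 2).toSubmodule ≤ 24 * 2 := finrank_component_two_le 1
    have h1 : 2 ≤ Module.finrank ℚ (spechtSub 3 [2, 1]).toSubmodule :=
      le_finrank_specht_one 2
    simp only [List.map_cons, List.map_nil, List.sum_cons, List.sum_nil, one_mul]
    omega

theorem decomposesAs_component_two_of_four :
    DecomposesAs (componentRep 4 2) [(2, [3, 1]), (1, [2, 2]), (1, [2, 1, 1])] := by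
  refine decomposesAs_of_detects (by simp) ?_ ?_ ?_
  · simp only [List.pairwise_cons, List.mem_cons, List.not_mem_nil, or_false, forall_eq_or_imp,
      forall_eq, IsEmpty.forall_iff, implies_true, List.Pairwise.nil, and_true]
    refine ⟨⟨⟨1, ?_⟩, ⟨1, ?_⟩⟩, ⟨2, ?_⟩⟩ <;> simp
  · simp only [List.mem_cons, List.not_mem_nil, or_false, forall_eq_or_imp, forall_eq]
    exact ⟨detects_component_two_one (by omega) (by simp),
      (pairDetects_meet_two (by omega) (by simp)).detects,
      (pairDetects_meet_one_one (by omega) (by simp)).detects⟩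
  -- 11 = 1·2 + 1·3 + 2·3 is matched by 2·3 + 2 + 3.
  · have h0 : 24 * Module.finrank ℚ (component 4 2).toSubmodule ≤ 24 * 11 := finrank_component_two_le 2
    have h1 : 3 ≤ Module.finrank ℚ (spechtSub 4 [3, 1]).toSubmodule :=
      le_finrank_specht_one 3
    have h2 : 4 ≤ 2 * Module.finrank ℚ (spechtSub 4 [2, 2]).toSubmodule :=
      le_finrank_specht_two 1
    have h3 : 6 ≤ 2 * Module.finrank ℚ (spechtSub 4 [2, 1, 1]).toSubmodule :=
      le_finrank_specht_one_one 2
    simp only [List.map_cons, List.map_nil, List.sum_cons, List.sum_nil, one_mul]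
    omega

theorem decomposesAs_component_two_of_five :
    DecomposesAs (componentRep 5 2)
      [(2, [4, 1]), (2, [3, 2]), (2, [3, 1, 1]), (1, [2, 2, 1])] := by
  refine decomposesAs_of_detects (by simp) ?_ ?_ ?_
  · simp only [List.pairwise_cons, List.mem_cons, List.not_mem_nil, or_false, forall_eq_or_imp,
      forall_eq, IsEmpty.forall_iff, implies_true, List.Pairwise.nil, and_true]
    refine ⟨⟨⟨1, ?_⟩, ⟨1, ?_⟩, ⟨1, ?_⟩⟩, ⟨⟨2, ?_⟩, ⟨1, ?_⟩⟩, ⟨1, ?_⟩⟩ <;> simp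
  · simp only [List.mem_cons, List.not_mem_nil, or_false, forall_eq_or_imp, forall_eq]
    exact ⟨detects_component_two_one (by omega) (by simp),
      detects_component_two_two (by omega) (by simp),
      detects_component_two_one_one (by omega) (by simp),
      (pairDetects_meet_two_one (by omega) (by simp)).detects⟩
  · have h0 : 24 * Module.finrank ℚ (component 5 2).toSubmodule ≤ 24 * 35 := finrank_component_two_le 3
    have h1 : 4 ≤ Module.finrank ℚ (spechtSub 5 [4, 1]).toSubmodule :=
      le_finrank_specht_one 4
    have h2 : 10 ≤ 2 * Module.finrank ℚ (spechtSub 5 [3, 2]).toSubmodule :=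
      le_finrank_specht_two 2
    have h3 : 12 ≤ 2 * Module.finrank ℚ (spechtSub 5 [3, 1, 1]).toSubmodule :=
      le_finrank_specht_one_one 3
    have h4 : 15 ≤ 3 * Module.finrank ℚ (spechtSub 5 [2, 2, 1]).toSubmodule :=
      le_finrank_specht_two_one 1
    simp only [List.map_cons, List.map_nil, List.sum_cons, List.sum_nil, one_mul]
    omega

theorem decomposesAs_component_two_of_six :
    DecomposesAs (componentRep 6 2)
      [(2, [5, 1]), (2, [4, 2]), (2, [4, 1, 1]), (1, [3, 3]), (2, [3, 2, 1])] := by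
  refine decomposesAs_of_detects (by simp) ?_ ?_ ?_
  · simp only [List.pairwise_cons, List.mem_cons, List.not_mem_nil, or_false, forall_eq_or_imp,
      forall_eq, IsEmpty.forall_iff, implies_true, List.Pairwise.nil, and_true]
    refine ⟨⟨⟨1, ?_⟩, ⟨1, ?_⟩, ⟨1, ?_⟩, ⟨1, ?_⟩⟩, ⟨⟨2, ?_⟩, ⟨1, ?_⟩, ⟨1, ?_⟩⟩,
      ⟨⟨1, ?_⟩, ⟨1, ?_⟩⟩, ⟨2, ?_⟩⟩ <;> simp
  · simp only [List.mem_cons, List.not_mem_nil, or_false, forall_eq_or_imp, forall_eq]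
    exact ⟨detects_component_two_one (by omega) (by simp),
      detects_component_two_two (by omega) (by simp),
      detects_component_two_one_one (by omega) (by simp),
      (pairDetects_disjoint_three (by omega) (by simp)).detects,
      detects_component_two_two_one (by omega) (by simp)⟩
  · have h0 : 24 * Module.finrank ℚ (component 6 2).toSubmodule ≤ 24 * 85 := finrank_component_two_le 4
    have h1 : 5 ≤ Module.finrank ℚ (spechtSub 6 [5, 1]).toSubmodule :=
      le_finrank_specht_one 5
    have h2 : 18 ≤ 2 * Module.finrank ℚ (spechtSub 6 [4, 2]).toSubmodule :=
      le_finrank_specht_two 3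
    have h3 : 20 ≤ 2 * Module.finrank ℚ (spechtSub 6 [4, 1, 1]).toSubmodule :=
      le_finrank_specht_one_one 4
    have h4 : 30 ≤ 6 * Module.finrank ℚ (spechtSub 6 [3, 3]).toSubmodule :=
      le_finrank_specht_three 1
    have h5 : 48 ≤ 3 * Module.finrank ℚ (spechtSub 6 [3, 2, 1]).toSubmodule :=
      le_finrank_specht_two_one 2
    simp only [List.map_cons, List.map_nil, List.sum_cons, List.sum_nil, one_mul]
    omega

end Decompositions

end Arnold

end

open Arnold
theorem theoremB :
    (∀ n : ℕ, 4 ≤ n → DecomposesAs (componentRep n 1)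
      [(1, pad n []), (1, pad n [1]), (1, pad n [2])]) ∧
    (∀ n : ℕ, 7 ≤ n → DecomposesAs (componentRep n 2)
      [(2, pad n [1]), (2, pad n [2]), (2, pad n [1, 1]), (1, pad n [3]),
        (2, pad n [2, 1]), (1, pad n [3, 1])]) ∧
    DecomposesAs (componentRep 2 2) [] ∧
    DecomposesAs (componentRep 3 2) [(1, [2, 1])] ∧
    DecomposesAs (componentRep 4 2) [(2, [3, 1]), (1, [2, 2]), (1, [2, 1, 1])] ∧
    DecomposesAs (componentRep 5 2)
      [(2, [4, 1]), (2, [3, 2]), (2, [3, 1, 1]), (1, [2, 2, 1])] ∧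
    DecomposesAs (componentRep 6 2)
      [(2, [5, 1]), (2, [4, 2]), (2, [4, 1, 1]), (1, [3, 3]), (2, [3, 2, 1])] := by
  refine ⟨fun n hn => ?_, fun n hn => ?_, decomposesAs_component_two_of_two,
    decomposesAs_component_two_of_three, decomposesAs_component_two_of_four,
    decomposesAs_component_two_of_five, decomposesAs_component_two_of_six⟩
  · obtain ⟨k, rfl⟩ := Nat.exists_eq_add_of_le' hn
    -- Once n is written as k + 4, the subtraction in `pad` computes and the shapes agree by
    -- definition.
    exact decomposesAs_component_one k
  · obtain ⟨k, rfl⟩ := Nat.exists_eq_add_of_le' hn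
    exact decomposesAs_component_two k
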